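/- **Setting.** Let $m_1,m_2\ge 1$ be integers with $m_1+m_2\le K$, and let $[K]=\{1,\dots,K\}$. For each stream $k\in[K]$ let $f_0^k,f_1^k$ be two probability densities with respect to a $\sigma$-finite measure $\mu^k$ on a measurable space $\mathcal X^k$. For $A\subset[K]$, under $\mathbb P_A$ the streams $\mathbf X^k=(\mathbf X^k_t)_{t\ge1}$, $k\in[K]$, are independent, and $\mathbf X^k$ is i.i.d. with density $f_1^k$ if $k\in A$ and $f_0^k$ if $k\notin A$. Let $\mathcal F_t$ be the $\sigma$-field generated by the observations of all streams up to time $t$. A sequential procedure is a pair $(T,D)$, where $T\in\{1,2,\dots\}\cup\{\infty\}$ is an $\{\mathcal F_t\}$-stopping time and $D\subset[K]$ is an $\mathcal F_T$-measurable random subset. For $\alpha,\beta\in(0,1)$ let $\Delta^{\mathrm{gfr}}_{m_1,m_2}(\alpha,\beta)$ be the class of all sequential procedures $(T,D)$ such that $$\max_{A\subset[K]}\mathbb P_A(|D\setminus A|\ge m_1)\le\alpha\quad\text{and}\quad \max_{A\subset[K]}\mathbb P_A(|A\setminus D|\ge m_2)\le\beta ,$$ and let $T_A^{\min}(\Delta^{\mathrm{gfr}}_{m_1,m_2}(\alpha,\beta))=\inf\{\mathbb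 E_A[T]:(T,D)\in\Delta^{\mathrm{gfr}}_{m_1,m_2}(\alpha,\beta)\}$. **The Leap rule.** Let $\lambda^k_t=\sum_{s=1}^t\log\big(f_1^k(\mathbf X^k_s)/f_0^k(\mathbf X^k_s)\big)$. At time $t$ let $\hat\lambda^{(1)}_t\le\dots\le\hat\lambda^{(p(t))}_t$ be the ordered values of the positive $\lambda_t^k$, attained at the streams $\hat\ell_1(t),\dots,\hat\ell_{p(t)}(t)$, and let $\check\lambda^{(1)}_t\le\dots\le\check\lambda^{(K-p(t))}_t$ be the ordered absolute values of the nonpositive $\lambda_t^k$, attained at the streams $\check\ell_1(t),\dots,\check\ell_{K-p(t)}(t)$; ties are broken by any fixed measurable rule. Set $\hat\lambda_t^{(j)}=\infty$ for $j>p(t)$ and $\check\lambda_t^{(j)}=\infty$ for $j>K-p(t)$ (and ignore the streams $\hat\ell_j(t)$, $\check\ell_j(t)$ with such indices $j$). For $a,b>0$ define, for $0\le i<m_1$, $$\hat\tau_i=\min\Big\{t\ge1:\sum_{j=1}^{m_1-i}\hat\lambda^{(j)}_t\ge b,\ \sum_{j=i+1}^{i+m_2}\check\lambda^{(j)}_t\ge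 a\Big\},\qquad \hat D_i=\{k:\lambda^k_{\hat\tau_i}>0\}\cup\{\check\ell_1(\hat\tau_i),\dots,\check\ell_i(\hat\tau_i)\},$$ and, for $1\le i<m_2$, $$\check\tau_i=\min\Big\{t\ge1:\sum_{j=i+1}^{i+m_1}\hat\lambda^{(j)}_t\ge b,\ \sum_{j=1}^{m_2-i}\check\lambda^{(j)}_t\ge a\Big\},\qquad \check D_i=\{k:\lambda^k_{\check\tau_i}>0\}\setminus\{\hat\ell_1(\check\tau_i),\dots,\hat\ell_i(\check\tau_i)\}.$$ The Leap rule is $\delta_L(a,b)=(T_L(a,b),D_L(a,b))$, where $T_L(a,b)$ is the minimum of all these stopping times and $D_L(a,b)$ is the union of the decisions $\hat D_i,\check D_i$ whose stopping time attains the minimum. Let $$a_{\alpha,\beta}=|\log\beta|+\log\Big[2^{m_2}\tbinom{K}{m_2}\Big],\qquad b_{\alpha,\beta}=|\log\alpha|+\log\Big[2^{m_1}\tbinom{K}{m_1}\Big].$$ **Theorem.** Suppose that for each $k\in[K]$ and each $(i,i')\in\{(0,1),(1,0)\}$, $$\int\log\big(f_i^k/f_{i'}^k\big)f_i^k\,d\mu^k>0\quad\text{and}\quad\int\big[\log\big(f_i^k/f_{i'}^k\big)\big]^2f_i^k\,d\mu^k<\infty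 .$$ Then $\delta_L(a_{\alpha,\beta},b_{\alpha,\beta})\in\Delta^{\mathrm{gfr}}_{m_1,m_2}(\alpha,\beta)$ and $\mathbb E_A[T_L(a_{\alpha,\beta},b_{\alpha,\beta})]<\infty$ for all $\alpha,\beta\in(0,1)$ and all $A\subset[K]$. Moreover, for every constant $C>0$ the family $\{\delta_L(a_{\alpha,\beta},b_{\alpha,\beta})\}$ is second-order asymptotically optimal in $\{\Delta^{\mathrm{gfr}}_{m_1,m_2}(\alpha,\beta)\}$ as $\alpha,\beta\to0$ with $C^{-1}\alpha\le\beta\le C\alpha$; that is, for each $A\subset[K]$, $$\limsup_{\substack{\alpha,\beta\to0\\ C^{-1}\alpha\le\beta\le C\alpha}}\Big(\mathbb E_A[T_L(a_{\alpha,\beta},b_{\alpha,\beta})]-T_A^{\min}\big(\Delta^{\mathrm{gfr}}_{m_1,m_2}(\alpha,\beta)\big)\Big)<\infty .$$ -/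

import Mathlib

open MeasureTheory
open scoped ENNReal NNReal

noncomputable section

/-- `K` data streams with observation spaces `𝒳 k`. For each stream there are a `σ`-finite reference
measure `μ k` and two probability densities with respect to it: `f₀ k` (null hypothesis) and
`f₁ k` (alternative). -/
structure StreamModel (K : ℕ) (𝒳 : Fin K → Type*) [∀ k, MeasurableSpace (𝒳 k)] where
  μ : ∀ k, Measure (𝒳 k)
  sigmaFinite_μ : ∀ k, SigmaFinite (μ k)
  f₀ : ∀ k, 𝒳 k → ℝ≥0
  f₁ : ∀ k, 𝒳 k → ℝ≥0
  measurable_f₀ : ∀ k, Measurable (f₀ k)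
  measurable_f₁ : ∀ k, Measurable (f₁ k)
  lintegral_f₀ : ∀ k, ∫⁻ x, (f₀ k x : ℝ≥0∞) ∂(μ k) = 1
  lintegral_f₁ : ∀ k, ∫⁻ x, (f₁ k x : ℝ≥0∞) ∂(μ k) = 1

/-- The square of `log (u / v)` as an extended number, with `log (u / 0) = ∞`. (When `u = 0` the
value is irrelevant: it is only integrated against the density whose value is `u`.) -/
def sqLogRatio (u v : ℝ≥0) : ℝ≥0∞ :=
  if v = 0 then ⊤ else ENNReal.ofReal (Real.log ((u : ℝ) / (v : ℝ)) ^ 2)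

/-- `∫ log (g / h) g dν > 0` and `∫ (log (g / h))² g dν < ∞`. The second condition is about an
extended-valued integrand, so it forces `h > 0` at `g dν`-almost every point; the integral in the
first condition is then absolutely convergent. -/
def PosKLFiniteSecondMoment {X : Type*} [MeasurableSpace X] (ν : Measure X) (g h : X → ℝ≥0) :
    Prop :=
  0 < ∫ x, Real.log ((g x : ℝ) / (h x : ℝ)) * (g x : ℝ) ∂ν ∧
    ∫⁻ x, sqLogRatio (g x) (h x) * (g x : ℝ≥0∞) ∂ν < ⊤

/-- The sample space: `ω s` is the vector of the observations of all streams at time `s + 1`. -/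
abbrev SamplePath (K : ℕ) (𝒳 : Fin K → Type*) : Type _ := ℕ → ∀ k : Fin K, 𝒳 k

/-- A sequential procedure as a pair: a stopping time `T` and a decision `D`, the set of the
streams declared to be signals. Measurability is imposed in `IsSequentialProcedure`. -/
structure SequentialRule (K : ℕ) (𝒳 : Fin K → Type*) where
  T : SamplePath K 𝒳 → ℕ∞
  D : SamplePath K 𝒳 → Finset (Fin K)

/-- `ℱ_n = σ(X_1, …, X_n)`. -/
def obsFiltration (K : ℕ) (𝒳 : Fin K → Type*) [∀ k, MeasurableSpace (𝒳 k)] :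
    Filtration ℕ (inferInstance : MeasurableSpace (SamplePath K 𝒳)) where
  seq n := ⨆ s ∈ Set.Iio n,
    MeasurableSpace.comap (fun ω : SamplePath K 𝒳 => ω s) inferInstance
  mono' _ _ hij := biSup_mono fun _ hs => lt_of_lt_of_le hs hij
  le' _ := iSup₂_le fun s _ => (measurable_pi_apply s).comap_le

/-- `T ≥ 1` is a stopping time of the observation filtration (possibly infinite), and `D` is
`ℱ_T`-measurable. -/
def IsSequentialProcedure {K : ℕ} {𝒳 : Fin K → Type*} [∀ k, MeasurableSpace (𝒳 k)]
    (δ : SequentialRule K 𝒳) : Prop :=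
  (∀ ω, 1 ≤ δ.T ω) ∧
    ∃ hT : IsStoppingTime (obsFiltration K 𝒳) δ.T,
      ∀ d : Finset (Fin K), MeasurableSet[hT.measurableSpace] {ω | δ.D ω = d}

/-- An ordering of the streams by increasing absolute value of their log-likelihood ratios: a
measurable way of breaking the ties. -/
structure EvidenceOrder (K : ℕ) where
  perm : (Fin K → ℝ) → Equiv.Perm (Fin K)
  sorted : ∀ x : Fin K → ℝ, Monotone fun i => |x (perm x i)|
  measurableSet_perm_eq : ∀ σ, MeasurableSet {x | perm x = σ}

namespace EvidenceOrder

variable {K : ℕ}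

/-- Ties can be broken by the index of the stream. -/
theorem nonempty : Nonempty (EvidenceOrder K) := by
  refine ⟨⟨fun x => Tuple.sort fun k => |x k|, fun x => ?_, fun σ => ?_⟩⟩
  · exact Tuple.monotone_sort (fun k => |x k|)
  · have h : {x : Fin K → ℝ | (Tuple.sort fun k => |x k|) = σ} =
        (⋂ (i : Fin K) (j : Fin K) (_ : i ≤ j), {x | |x (σ i)| ≤ |x (σ j)|}) ∩
          ⋂ (i : Fin K) (j : Fin K) (_ : i < j) (_ : ¬ σ i < σ j),
            {x | |x (σ i)| = |x (σ j)|}ᶜ := by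
      ext x
      have h' := Tuple.eq_sort_iff (f := fun k => |x k|) (σ := σ)
      rw [eq_comm] at h'
      simp only [Set.mem_inter_iff, Set.mem_iInter, Set.mem_compl_iff]
      refine h'.trans (and_congr Iff.rfl ?_)
      exact forall_congr' fun i => forall_congr' fun j => forall_congr' fun _ =>
        not_imp_not.symm
    rw [h]
    have hm : ∀ k : Fin K, Measurable fun x : Fin K → ℝ => |x k| := fun k =>
      (measurable_pi_apply k).abs
    refine MeasurableSet.inter ?_ ?_
    · exact MeasurableSet.iInter fun i => MeasurableSet.iInter fun j =>
        MeasurableSet.iInter fun _ => measurableSet_le (hm _) (hm _)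
    · exact MeasurableSet.iInter fun i => MeasurableSet.iInter fun j =>
        MeasurableSet.iInter fun _ => MeasurableSet.iInter fun _ =>
          (measurableSet_eq_fun (hm _) (hm _)).compl

/-- The streams with a positive log-likelihood ratio, in increasing order of it:
`ℓ̂_1, …, ℓ̂_p`. -/
def posList (o : EvidenceOrder K) (x : Fin K → ℝ) : List (Fin K) :=
  (List.ofFn (o.perm x)).filter fun k => 0 < x k

/-- The streams with a nonpositive log-likelihood ratio, in increasing order of its absolute value:
`ℓ̌_1, …, ℓ̌_{K-p}`. -/
def negList (o : EvidenceOrder K) (x : Fin K → ℝ) : List (Fin K) :=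
  (List.ofFn (o.perm x)).filter fun k => x k ≤ 0

end EvidenceOrder

/-- The `j`-th (`j = 1, 2, …`) absolute value along the list `l`, and `∞` beyond its end. -/
def orderStat {K : ℕ} (x : Fin K → ℝ) (l : List (Fin K)) (j : ℕ) : ℝ≥0∞ :=
  match l[j - 1]? with
  | some k => ENNReal.ofReal |x k|
  | none => ⊤

/-- `∑_{j=i+1}^{i+n} λ^{(j)}`. -/
def orderStatSum {K : ℕ} (x : Fin K → ℝ) (l : List (Fin K)) (i n : ℕ) : ℝ≥0∞ :=
  ∑ j ∈ Finset.Icc (i + 1) (i + n), orderStat x l j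

/-- The first time `t ≥ 1` at which `p` holds (`∞` if there is none). -/
def firstTime (p : ℕ → Prop) : ℕ∞ := ⨅ (t : ℕ) (_ : 1 ≤ t ∧ p t), (t : ℕ∞)

namespace StreamModel

variable {K : ℕ} {𝒳 : Fin K → Type*} [∀ k, MeasurableSpace (𝒳 k)] (M : StreamModel K 𝒳)

/-- For each stream, both Kullback-Leibler divergences are positive, and the log-likelihood ratio
has a finite second moment under both hypotheses. -/
def LLRMomentAssumption : Prop :=
  ∀ k, PosKLFiniteSecondMoment (M.μ k) (M.f₁ k) (M.f₀ k) ∧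
    PosKLFiniteSecondMoment (M.μ k) (M.f₀ k) (M.f₁ k)

/-- The law of one observation in stream `k` when the set of signals is `A`. -/
def law (A : Finset (Fin K)) (k : Fin K) : Measure (𝒳 k) :=
  (M.μ k).withDensity fun x => if k ∈ A then (M.f₁ k x : ℝ≥0∞) else (M.f₀ k x : ℝ≥0∞)

instance (A : Finset (Fin K)) (k : Fin K) : IsProbabilityMeasure (M.law A k) := by
  constructor
  by_cases h : k ∈ A
  · simp [law, h, M.lintegral_f₁ k]
  · simp [law, h, M.lintegral_f₀ k]

/-- `ℙ_A`: the observation vectors are independent and identically distributed over time, and the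
streams are independent. -/
def P (A : Finset (Fin K)) : Measure (SamplePath K 𝒳) :=
  Measure.infinitePi fun _ : ℕ => Measure.pi (M.law A)

instance (A : Finset (Fin K)) : IsProbabilityMeasure (M.P A) := by
  unfold P; infer_instance

/-- The log-likelihood ratio `λ_t^k` of stream `k` at time `t`. -/
def llr (ω : SamplePath K 𝒳) (t : ℕ) (k : Fin K) : ℝ :=
  ∑ s ∈ Finset.range t, Real.log ((M.f₁ k (ω s k) : ℝ) / (M.f₀ k (ω s k) : ℝ))

/-- The expected sample size `𝔼_A[T]`. -/
def ESS (A : Finset (Fin K)) (δ : SequentialRule K 𝒳) : ℝ≥0∞ :=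
  ∫⁻ ω, (δ.T ω : ℝ≥0∞) ∂(M.P A)

/-- `T_A^min(Δ)`: the smallest expected sample size that is achievable in the class `Δ`. -/
def minESS (A : Finset (Fin K)) (Δ : Set (SequentialRule K 𝒳)) : ℝ≥0∞ :=
  ⨅ δ ∈ Δ, M.ESS A δ

/-- The class of the procedures that control the generalized familywise error rates:
`ℙ_A(|D ∖ A| ≥ m₁) ≤ α` and `ℙ_A(|A ∖ D| ≥ m₂) ≤ β` for every `A`. -/
def gfrClass (m₁ m₂ : ℕ) (α β : ℝ) : Set (SequentialRule K 𝒳) :=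
  {δ | IsSequentialProcedure δ ∧
    (∀ A, M.P A {ω | m₁ ≤ (δ.D ω \ A).card} ≤ ENNReal.ofReal α) ∧
    (∀ A, M.P A {ω | m₂ ≤ (A \ δ.D ω).card} ≤ ENNReal.ofReal β)}

section Leap

variable (o : EvidenceOrder K) (m₁ m₂ : ℕ) (a b : ℝ)

/-- The stopping time `τ̂_i`. -/
def tauHat (i : ℕ) (ω : SamplePath K 𝒳) : ℕ∞ :=
  firstTime fun t =>
    ENNReal.ofReal b ≤ orderStatSum (M.llr ω t) (o.posList (M.llr ω t)) 0 (m₁ - i) ∧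
    ENNReal.ofReal a ≤ orderStatSum (M.llr ω t) (o.negList (M.llr ω t)) i m₂

/-- The stopping time `τ̌_i`. -/
def tauCheck (i : ℕ) (ω : SamplePath K 𝒳) : ℕ∞ :=
  firstTime fun t =>
    ENNReal.ofReal b ≤ orderStatSum (M.llr ω t) (o.posList (M.llr ω t)) i m₁ ∧
    ENNReal.ofReal a ≤ orderStatSum (M.llr ω t) (o.negList (M.llr ω t)) 0 (m₂ - i)

/-- The decision `D̂_i` for the vector `x` of log-likelihood ratios: the positive streams together
with the `i` least significant nonpositive ones. -/
def decHat (i : ℕ) (x : Fin K → ℝ) : Finset (Fin K) :=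
  (Finset.univ.filter fun k => 0 < x k) ∪ ((o.negList x).take i).toFinset

/-- The decision `Ď_i` for the vector `x` of log-likelihood ratios: the positive streams except
the `i` least significant ones. -/
def decCheck (i : ℕ) (x : Fin K → ℝ) : Finset (Fin K) :=
  (Finset.univ.filter fun k => 0 < x k) \ ((o.posList x).take i).toFinset

/-- `T_L = min {τ̂_0, …, τ̂_{m₁-1}, τ̌_1, …, τ̌_{m₂-1}}`. -/
def leapTime (ω : SamplePath K 𝒳) : ℕ∞ :=
  (⨅ i ∈ Finset.range m₁, M.tauHat o m₁ m₂ a b i ω) ⊓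
    ⨅ i ∈ Finset.Ico 1 m₂, M.tauCheck o m₁ m₂ a b i ω

open Classical in
/-- `D_L`: the union of the decisions `D̂_i` and `Ď_i` whose stopping times attain the minimum
(and the empty set on the event that the rule never stops). -/
def leapDecision (ω : SamplePath K 𝒳) : Finset (Fin K) :=
  let T := M.leapTime o m₁ m₂ a b ω
  if T = ⊤ then ∅ else
    (((Finset.range m₁).filter fun i => M.tauHat o m₁ m₂ a b i ω = T).biUnion
        fun i => decHat o i (M.llr ω T.toNat)) ∪
      (((Finset.Ico 1 m₂).filter fun i => M.tauCheck o m₁ m₂ a b i ω = T).biUnion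
        fun i => decCheck o i (M.llr ω T.toNat))

/-- The Leap rule `δ_L(a, b)`. -/
def leapRule : SequentialRule K 𝒳 where
  T := M.leapTime o m₁ m₂ a b
  D := M.leapDecision o m₁ m₂ a b

end Leap

/-- The family `δ` is second-order asymptotically optimal in the family of classes `Δ` as
`θ = (α, β) → (0, 0)` within `Θ`: `δ θ ∈ Δ θ` for all `θ ∈ (0, 1)²`, and for every `A` the expected
sample sizes of `δ` are finite and
`limsup_{θ → 0, θ ∈ Θ} (𝔼_A[T(θ)] - T_A^min(Δ(θ))) < ∞`. -/
def IsSecondOrderOptimal (Θ : Set (ℝ × ℝ)) (δ : ℝ × ℝ → SequentialRule K 𝒳)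
    (Δ : ℝ × ℝ → Set (SequentialRule K 𝒳)) : Prop :=
  (∀ θ ∈ Set.Ioo (0 : ℝ) 1 ×ˢ Set.Ioo (0 : ℝ) 1, δ θ ∈ Δ θ) ∧
    ∀ A : Finset (Fin K),
      (∀ θ ∈ Set.Ioo (0 : ℝ) 1 ×ˢ Set.Ioo (0 : ℝ) 1, M.ESS A (δ θ) < ⊤) ∧
      Filter.limsup (fun θ => (M.ESS A (δ θ) : EReal) - (M.minESS A (Δ θ) : EReal))
        (nhdsWithin (0, 0) Θ) < ⊤

end StreamModel

/-- The threshold `|log γ| + log (2^m * binom(K, m))`. -/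
def leapThreshold (K m : ℕ) (γ : ℝ) : ℝ :=
  |Real.log γ| + Real.log (2 ^ m * (K.choose m : ℝ))

/-- The pairs `(α, β) ∈ (0, 1)²` with `C⁻¹ α ≤ β ≤ C α`. -/
def sameRate (C : ℝ) : Set (ℝ × ℝ) :=
  {θ | θ ∈ Set.Ioo (0 : ℝ) 1 ×ˢ Set.Ioo (0 : ℝ) 1 ∧ C⁻¹ * θ.1 ≤ θ.2 ∧ θ.2 ≤ C * θ.1}

end

/-! The minimal expected sample size is never computed. The Leap rule is compared with each
competitor `(T, D)` of the class, and shown to run on average at most a bounded time beyond `T`.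
Write `Z_n(B)` for the log-likelihood ratio of `ℙ_A` against `ℙ_B` at time `n` (`jointLLR`), and `h
= max a b`.

Error control. When the Leap rule errs at `A`, some small set `S` of streams, added to or removed
from `A`, gives a parameter whose likelihood ratio against `ℙ_A` has reached `exp b` or `exp a`. The
maximal inequality and a union bound over `S` conclude; the factors `2 ^ m * K.choose m` in the
thresholds count these sets.

Optimality rests on three facts. (1) Combinatorics (`leapStop_of_forall_isError`): for any set `D`,
if `Z_n(B) ≥ h` at every `B` where `D` makes too many errors, the stopping condition of the Leap
rule holds at time `n`. So from time `T` on, the rule only waits for the `Z(B)` with `D` erroneous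
at `B`. (2) Drift (`exists_excursion_bound`): if `D` is not erroneous at `A`, all these walks have
positive drift under `ℙ_A`. A sum of smoothed positive parts of `h - Z(B)` is a Lyapunov function,
and finite second moments suffice to bound the expected wait by a constant times `∑ 𝔼_A[(h -
Z_T(B))⁺ + L]`. (3) Change of measure: since `v⁺ ≤ exp v`, the deficit on an event `E` costs at most
`exp h * ℙ_B(E)`. Summed over the events `T = n, D = d` with `d` erroneous at `B`, this is at most
`exp h * (α + β)`, which is bounded when `α` and `β` are comparable.

When `D` is erroneous at `A` itself, the wait is bounded with `(h - z)⁺ ≤ h + exp (-z)`, and the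
term `h * ℙ_A(error)` is bounded because `h ≤ exp h`. -/

/-! ### Product densities and cylinder events. -/

/-- The product of measures with densities has the product density. -/
theorem MeasureTheory.Measure.pi_withDensity_prod {ι : Type*} [Fintype ι] {X : ι → Type*}
    [∀ i, MeasurableSpace (X i)] (ν : ∀ i, Measure (X i)) [∀ i, IsProbabilityMeasure (ν i)]
    (f : ∀ i, X i → ℝ≥0∞) (hf : ∀ i, Measurable (f i))
    [∀ i, IsProbabilityMeasure ((ν i).withDensity (f i))] :
    Measure.pi (fun i => (ν i).withDensity (f i)) =
      (Measure.pi ν).withDensity fun x => ∏ i, f i (x i) := by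
  refine Measure.pi_eq fun s hs => ?_
  rw [withDensity_apply _ (MeasurableSet.univ_pi hs),
    ← lintegral_indicator (MeasurableSet.univ_pi hs)]
  have h1 : ∀ x : ∀ i, X i, (Set.univ.pi s).indicator (fun x => ∏ i, f i (x i)) x =
      ∏ i, (s i).indicator (f i) (x i) := by
    intro x
    by_cases hx : x ∈ Set.univ.pi s
    · rw [Set.indicator_of_mem hx]
      exact Finset.prod_congr rfl fun i _ => (Set.indicator_of_mem (hx i trivial) _).symm
    · rw [Set.indicator_of_notMem hx]
      simp only [Set.mem_pi, Set.mem_univ, true_imp_iff, not_forall] at hx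
      obtain ⟨i, hi⟩ := hx
      exact (Finset.prod_eq_zero (Finset.mem_univ i) (Set.indicator_of_notMem hi _)).symm
  simp_rw [h1]
  have hm : ∀ i, Measurable ((s i).indicator (f i)) := fun i => (hf i).indicator (hs i)
  have hind : ProbabilityTheory.iIndepFun
      (fun i (x : ∀ i, X i) => (s i).indicator (f i) (x i)) (Measure.pi ν) :=
    ProbabilityTheory.iIndepFun_pi fun i => (hm i).aemeasurable
  rw [ProbabilityTheory.lintegral_prod_eq_prod_lintegral_of_indepFun _ _ hind
    fun i => (hm i).comp (measurable_pi_apply i)]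
  refine Finset.prod_congr rfl fun i _ => ?_
  rw [withDensity_apply _ (hs i), ← lintegral_indicator (hs i),
    ← (measurePreserving_eval ν i).lintegral_comp (hm i)]

theorem measurable_obsFiltration_eval {K : ℕ} {𝒳 : Fin K → Type*} [∀ k, MeasurableSpace (𝒳 k)]
    {s n : ℕ} (h : s < n) :
    Measurable[obsFiltration K 𝒳 n] fun ω : SamplePath K 𝒳 => ω s := by
  refine measurable_iff_comap_le.2 ?_
  exact le_iSup₂_of_le (f := fun s (_ : s ∈ Set.Iio n) =>
    MeasurableSpace.comap (fun ω : SamplePath K 𝒳 => ω s) inferInstance) s h le_rfl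

/-- An event of the observations up to time `n` is a cylinder. -/
theorem exists_preimage_restrict_eq {K : ℕ} {𝒳 : Fin K → Type*} [∀ k, MeasurableSpace (𝒳 k)]
    {n : ℕ} {E : Set (SamplePath K 𝒳)} (hE : MeasurableSet[obsFiltration K 𝒳 n] E) :
    ∃ S : Set (∀ _ : Finset.range n, ∀ k, 𝒳 k), MeasurableSet S ∧
      (Finset.range n).restrict ⁻¹' S = E := by
  have h : (obsFiltration K 𝒳 n : MeasurableSpace (SamplePath K 𝒳)) ≤
      MeasurableSpace.comap (Finset.range n).restrict MeasurableSpace.pi := by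
    refine iSup₂_le fun s hs => ?_
    have : (fun ω : SamplePath K 𝒳 => ω s) =
        (fun y : ∀ _ : Finset.range n, ∀ k, 𝒳 k => y ⟨s, Finset.mem_range.2 hs⟩) ∘
          (Finset.range n).restrict := rfl
    rw [this, ← MeasurableSpace.comap_comp]
    exact MeasurableSpace.comap_mono (measurable_pi_apply _).comap_le
  exact h _ hE

/-! ### Likelihood ratios between parameters, change of measure, maximal inequality. -/

namespace StreamModel

variable {K : ℕ} {𝒳 : Fin K → Type*} [∀ k, MeasurableSpace (𝒳 k)] (M : StreamModel K 𝒳)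

/-- `1_A(k) - 1_B(k)`. -/
noncomputable def diffSign (A B : Finset (Fin K)) (k : Fin K) : ℝ :=
  (if k ∈ A then 1 else 0) - (if k ∈ B then 1 else 0)

/-- The log-likelihood ratio of one observation of stream `k`. -/
noncomputable def logRatio (k : Fin K) (x : 𝒳 k) : ℝ :=
  Real.log ((M.f₁ k x : ℝ) / (M.f₀ k x : ℝ))

/-- The log-likelihood ratio of `ℙ_A` against `ℙ_B` of one observation of all streams. -/
noncomputable def jointLogRatio (A B : Finset (Fin K)) (y : ∀ k, 𝒳 k) : ℝ :=
  ∑ k, diffSign A B k * M.logRatio k (y k)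

/-- The log-likelihood ratio of `ℙ_A` against `ℙ_B` at time `n`. -/
noncomputable def jointLLR (A B : Finset (Fin K)) (n : ℕ) (ω : SamplePath K 𝒳) : ℝ :=
  ∑ s ∈ Finset.range n, M.jointLogRatio A B (ω s)

/-- Links the two views of the process: a random walk with i.i.d. increments, to which drift
arguments apply, and a linear functional of the vector of stream log-likelihood ratios, on which the
Leap rule acts. -/
theorem jointLLR_eq (A B : Finset (Fin K)) (n : ℕ) (ω : SamplePath K 𝒳) :
    M.jointLLR A B n ω = ∑ k, diffSign A B k * M.llr ω n k := by
  simp only [jointLLR, jointLogRatio, llr, Finset.mul_sum]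
  exact Finset.sum_comm

theorem measurable_logRatio (k : Fin K) : Measurable (M.logRatio k) :=
  Real.measurable_log.comp ((M.measurable_f₁ k).coe_nnreal_real.div
    (M.measurable_f₀ k).coe_nnreal_real)

theorem measurable_jointLogRatio (A B : Finset (Fin K)) : Measurable (M.jointLogRatio A B) :=
  Finset.measurable_sum _ fun k _ =>
    ((M.measurable_logRatio k).comp (measurable_pi_apply k)).const_mul _

theorem measurable_jointLLR_obsFiltration (A B : Finset (Fin K)) (n : ℕ) :
    Measurable[obsFiltration K 𝒳 n] (M.jointLLR A B n) :=
  Finset.measurable_sum _ fun _ hs => (M.measurable_jointLogRatio A B).comp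
    (measurable_obsFiltration_eval (Finset.mem_range.1 hs))

theorem measurable_jointLLR (A B : Finset (Fin K)) (n : ℕ) : Measurable (M.jointLLR A B n) :=
  (M.measurable_jointLLR_obsFiltration A B n).mono ((obsFiltration K 𝒳).le n) le_rfl

theorem measurable_llr_obsFiltration (n : ℕ) :
    Measurable[obsFiltration K 𝒳 n] fun ω : SamplePath K 𝒳 => M.llr ω n := by
  let : MeasurableSpace (SamplePath K 𝒳) := obsFiltration K 𝒳 n
  refine measurable_pi_lambda _ fun k => Finset.measurable_sum _ fun s hs => ?_
  exact (M.measurable_logRatio k).comp ((measurable_pi_apply k).comp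
    (measurable_obsFiltration_eval (Finset.mem_range.1 hs)))

variable {M}

/-- A finite second moment of the log-likelihood ratio forces absolute continuity. -/
theorem ae_ne_zero_of_posKL {X : Type*} [MeasurableSpace X] {ν : Measure X} {g h : X → ℝ≥0}
    (hg : Measurable g) (hh : Measurable h) (H : PosKLFiniteSecondMoment ν g h) :
    ∀ᵐ x ∂ν, g x ≠ 0 → h x ≠ 0 := by
  have hm : Measurable fun x => sqLogRatio (g x) (h x) * (g x : ℝ≥0∞) := by
    refine Measurable.mul (Measurable.ite (hh (measurableSet_singleton 0)) measurable_const ?_)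
      hg.coe_nnreal_ennreal
    exact ((Real.measurable_log.comp (hg.coe_nnreal_real.div hh.coe_nnreal_real)).pow_const
      2).ennreal_ofReal
  filter_upwards [ae_lt_top hm H.2.ne] with x hx h1 h2
  simp [sqLogRatio, h2, h1, ENNReal.top_mul] at hx

/-- The second-moment condition under both hypotheses makes `f₀` and `f₁` vanish at almost the same
points. Off these points the formula is algebra; at them both sides carry a zero density, so the
default value of the logarithm is harmless. -/
theorem law_eq_withDensity (hM : M.LLRMomentAssumption) (A B : Finset (Fin K)) (k : Fin K) :
    M.law B k = (M.law A k).withDensity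
      fun x => ENNReal.ofReal (Real.exp (-(diffSign A B k * M.logRatio k x))) := by
  have hme : Measurable fun x =>
      ENNReal.ofReal (Real.exp (-(diffSign A B k * M.logRatio k x))) :=
    (Real.measurable_exp.comp ((M.measurable_logRatio k).const_mul _).neg).ennreal_ofReal
  have h01 := ae_ne_zero_of_posKL (M.measurable_f₁ k) (M.measurable_f₀ k) (hM k).1
  have h10 := ae_ne_zero_of_posKL (M.measurable_f₀ k) (M.measurable_f₁ k) (hM k).2
  have hd : Measurable fun x => if k ∈ A then (M.f₁ k x : ℝ≥0∞) else (M.f₀ k x : ℝ≥0∞) := by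
    split_ifs
    · exact (M.measurable_f₁ k).coe_nnreal_ennreal
    · exact (M.measurable_f₀ k).coe_nnreal_ennreal
  unfold law
  rw [← withDensity_mul _ hd hme]
  refine withDensity_congr_ae ?_
  filter_upwards [h01, h10] with x hx hx'
  simp only [Pi.mul_apply]
  by_cases h0 : M.f₀ k x = 0
  · have h1 : M.f₁ k x = 0 := by by_contra h; exact hx h h0
    simp [h0, h1]
  · have h1 : M.f₁ k x ≠ 0 := hx' h0
    have p0 : (0 : ℝ) < M.f₀ k x := NNReal.coe_pos.2 (pos_iff_ne_zero.2 h0)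
    have p1 : (0 : ℝ) < M.f₁ k x := NNReal.coe_pos.2 (pos_iff_ne_zero.2 h1)
    have e0 : (M.f₀ k x : ℝ≥0∞) = ENNReal.ofReal (M.f₀ k x : ℝ) := by simp
    have e1 : (M.f₁ k x : ℝ≥0∞) = ENNReal.ofReal (M.f₁ k x : ℝ) := by simp
    rw [e0, e1]
    by_cases hA : k ∈ A <;> by_cases hB : k ∈ B <;>
      simp only [diffSign, logRatio, hA, hB, if_true, if_false]
    · simp
    · rw [← ENNReal.ofReal_mul p1.le]
      congr 1
      rw [sub_zero, one_mul, Real.exp_neg, Real.exp_log (div_pos p1 p0)]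
      field_simp
    · rw [← ENNReal.ofReal_mul p0.le]
      congr 1
      rw [zero_sub, neg_one_mul, neg_neg, Real.exp_log (div_pos p1 p0)]
      field_simp
    · simp

theorem pi_law_eq_withDensity (hM : M.LLRMomentAssumption) (A B : Finset (Fin K)) :
    Measure.pi (M.law B) = (Measure.pi (M.law A)).withDensity
      fun y => ENNReal.ofReal (Real.exp (-M.jointLogRatio A B y)) := by
  have he : M.law B = fun k => (M.law A k).withDensity
      fun x => ENNReal.ofReal (Real.exp (-(diffSign A B k * M.logRatio k x))) :=
    funext fun k => law_eq_withDensity hM A B k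
  have : ∀ k, IsProbabilityMeasure ((M.law A k).withDensity
      fun x => ENNReal.ofReal (Real.exp (-(diffSign A B k * M.logRatio k x)))) := fun k => by
    rw [← law_eq_withDensity hM A B k]; infer_instance
  rw [he, Measure.pi_withDensity_prod (M.law A)
    (fun k x => ENNReal.ofReal (Real.exp (-(diffSign A B k * M.logRatio k x)))) fun k =>
    (Real.measurable_exp.comp ((M.measurable_logRatio k).const_mul _).neg).ennreal_ofReal]
  congr 1
  funext y
  rw [← ENNReal.ofReal_prod_of_nonneg fun _ _ => (Real.exp_pos _).le, ← Real.exp_sum,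
    jointLogRatio, Finset.sum_neg_distrib]

/-- Change of measure on the observations up to time `n`. -/
theorem setLIntegral_exp_neg_jointLLR (hM : M.LLRMomentAssumption) (A B : Finset (Fin K)) {n : ℕ}
    {E : Set (SamplePath K 𝒳)} (hE : MeasurableSet[obsFiltration K 𝒳 n] E) :
    ∫⁻ ω in E, ENNReal.ofReal (Real.exp (-M.jointLLR A B n ω)) ∂(M.P A) = M.P B E := by
  obtain ⟨S, hS, rfl⟩ := exists_preimage_restrict_eq hE
  have hr : Measurable (Finset.restrict (π := fun _ : ℕ => ∀ k, 𝒳 k) (Finset.range n)) :=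
    Finset.measurable_restrict _
  have hmap : ∀ A, (M.P A).map (Finset.range n).restrict =
      Measure.pi fun _ : Finset.range n => Measure.pi (M.law A) := fun A => by
    unfold P; exact Measure.infinitePi_map_restrict _
  have hme : Measurable fun y : ∀ k, 𝒳 k =>
      ENNReal.ofReal (Real.exp (-M.jointLogRatio A B y)) :=
    (Real.measurable_exp.comp (M.measurable_jointLogRatio A B).neg).ennreal_ofReal
  have hp : Measurable fun y : ∀ _ : Finset.range n, ∀ k, 𝒳 k =>
      ∏ i, ENNReal.ofReal (Real.exp (-M.jointLogRatio A B (y i))) :=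
    Finset.measurable_fun_prod _ fun i _ => hme.comp (measurable_pi_apply i)
  rw [← Measure.map_apply hr hS, hmap]
  have : IsProbabilityMeasure ((Measure.pi (M.law A)).withDensity
      fun y => ENNReal.ofReal (Real.exp (-M.jointLogRatio A B y))) := by
    rw [← pi_law_eq_withDensity hM A B]; infer_instance
  have he : (fun _ : Finset.range n => Measure.pi (M.law B)) = fun _ : Finset.range n =>
      (Measure.pi (M.law A)).withDensity
        fun y => ENNReal.ofReal (Real.exp (-M.jointLogRatio A B y)) :=
    funext fun _ => pi_law_eq_withDensity hM A B
  rw [he, Measure.pi_withDensity_prod _ _ fun _ => hme, withDensity_apply _ hS, ← hmap,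
    setLIntegral_map hS hp hr]
  refine setLIntegral_congr_fun (hr hS) fun ω _ => ?_
  rw [← ENNReal.ofReal_prod_of_nonneg fun _ _ => (Real.exp_pos _).le, ← Real.exp_sum, jointLLR,
    Finset.sum_neg_distrib]
  congr 3
  exact (Finset.sum_coe_sort (Finset.range n) fun s => M.jointLogRatio A B (ω s)).symm

theorem measure_le_setLIntegral_of_le (A : Finset (Fin K)) {E : Set (SamplePath K 𝒳)}
    (hE : MeasurableSet E) {f : SamplePath K 𝒳 → ℝ≥0∞} (h : ∀ ω ∈ E, 1 ≤ f ω) :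
    M.P A E ≤ ∫⁻ ω in E, f ω ∂(M.P A) := by
  calc M.P A E = ∫⁻ _ in E, 1 ∂(M.P A) := by simp
    _ ≤ _ := setLIntegral_mono' hE h

/-- The maximal inequality for the likelihood ratio. -/
theorem measure_exists_le_neg_jointLLR (hM : M.LLRMomentAssumption) (A B : Finset (Fin K))
    (b : ℝ) :
    M.P A {ω | ∃ n, b ≤ -M.jointLLR A B n ω} ≤ ENNReal.ofReal (Real.exp (-b)) := by
  set F : ℕ → Set (SamplePath K 𝒳) := fun n => {ω | b ≤ -M.jointLLR A B n ω} with hF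
  have hFm : ∀ n m, n ≤ m → MeasurableSet[obsFiltration K 𝒳 m] (F n) := fun n m h =>
    (obsFiltration K 𝒳).mono h _
      (measurableSet_le measurable_const (M.measurable_jointLLR_obsFiltration A B n).neg)
  -- Splitting by the first crossing time gives disjoint pieces, the `n`-th one known at time `n`,
  -- so that the change of measure applies to each piece.
  have hE : {ω | ∃ n, b ≤ -M.jointLLR A B n ω} = ⋃ n, disjointed F n := by
    rw [iUnion_disjointed]; ext ω; simp [hF]
  have hdm : ∀ n, MeasurableSet[obsFiltration K 𝒳 n] (disjointed F n) := fun n => by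
    rw [disjointed_eq_inter_compl]
    exact (hFm n n le_rfl).inter (MeasurableSet.iInter fun j => MeasurableSet.iInter fun hj =>
      (hFm j n (le_of_lt hj)).compl)
  have hm : ∀ n, MeasurableSet (disjointed F n) := fun n => (obsFiltration K 𝒳).le n _ (hdm n)
  have key : ∀ n, M.P A (disjointed F n) ≤
      ENNReal.ofReal (Real.exp (-b)) * M.P B (disjointed F n) := fun n => by
    rw [← setLIntegral_exp_neg_jointLLR hM A B (hdm n), ← lintegral_const_mul' _ _ (by simp)]
    refine measure_le_setLIntegral_of_le A (hm n) fun ω hω => ?_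
    have hb : b ≤ -M.jointLLR A B n ω := disjointed_subset F n hω
    rw [← ENNReal.ofReal_mul (Real.exp_pos _).le, ← Real.exp_add, ← ENNReal.ofReal_one]
    exact ENNReal.ofReal_le_ofReal (Real.one_le_exp (by linarith))
  rw [hE, measure_iUnion (disjoint_disjointed F) hm]
  calc ∑' n, M.P A (disjointed F n)
      ≤ ∑' n, ENNReal.ofReal (Real.exp (-b)) * M.P B (disjointed F n) :=
        ENNReal.tsum_le_tsum key
    _ = ENNReal.ofReal (Real.exp (-b)) * M.P B (⋃ n, disjointed F n) := by
        rw [ENNReal.tsum_mul_left, measure_iUnion (disjoint_disjointed F) hm]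
    _ ≤ ENNReal.ofReal (Real.exp (-b)) := mul_le_of_le_one_right' prob_le_one

end StreamModel

/-! ### A smoothed positive part. -/

/-- A convex function that grows linearly at `∞` and vanishes at `-∞`, of curvature at most
`1 / (2 L)`. -/
noncomputable def softPos (L v : ℝ) : ℝ := (v + √(v ^ 2 + L ^ 2)) / 2

/-- The derivative of `softPos`. -/
noncomputable def softPosDeriv (L v : ℝ) : ℝ := (1 + v / √(v ^ 2 + L ^ 2)) / 2

section SoftPos

variable {L : ℝ} (v x : ℝ)

theorem abs_le_sqrt_sq_add : |v| ≤ √(v ^ 2 + L ^ 2) :=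
  Real.abs_le_sqrt (by nlinarith [sq_nonneg L])

theorem le_sqrt_sq_add : L ≤ √(v ^ 2 + L ^ 2) :=
  Real.le_sqrt_of_sq_le (by nlinarith [sq_nonneg v])

theorem softPos_nonneg : 0 ≤ softPos L v := by
  have := (abs_le.1 (abs_le_sqrt_sq_add (L := L) v)).1
  unfold softPos; linarith

theorem softPos_le (hL : 0 < L) : softPos L v ≤ max v 0 + L := by
  have h : √(v ^ 2 + L ^ 2) ≤ |v| + L := by
    refine Real.sqrt_le_iff.2 ⟨by positivity, ?_⟩
    nlinarith [sq_abs v, abs_nonneg v]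
  unfold softPos
  rcases le_total 0 v with hv | hv
  · rw [abs_of_nonneg hv] at h; rw [max_eq_left hv]; linarith
  · rw [abs_of_nonpos hv] at h; rw [max_eq_right hv]; linarith

theorem softPosDeriv_nonneg : 0 ≤ softPosDeriv L v := by
  have h : |v / √(v ^ 2 + L ^ 2)| ≤ 1 := by
    rw [abs_div, abs_of_nonneg (Real.sqrt_nonneg _)]
    exact div_le_one_of_le₀ (abs_le_sqrt_sq_add v) (Real.sqrt_nonneg _)
  have h' := (abs_le.1 h).1
  unfold softPosDeriv; linarith

theorem softPosDeriv_le_one : softPosDeriv L v ≤ 1 := by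
  have h : v / √(v ^ 2 + L ^ 2) ≤ 1 :=
    div_le_one_of_le₀ ((le_abs_self v).trans (abs_le_sqrt_sq_add v)) (Real.sqrt_nonneg _)
  unfold softPosDeriv; linarith

theorem half_le_softPosDeriv {v : ℝ} (hv : 0 ≤ v) : 1 / 2 ≤ softPosDeriv L v := by
  have : 0 ≤ v / √(v ^ 2 + L ^ 2) := by positivity
  unfold softPosDeriv; linarith

/-- The square root lies below its tangent: `√(r² + u) ≤ r + u / (2 r)` with `u = x² - 2 v x`. The
first-order part of `u` gives the derivative, and `r ≥ L` bounds the quadratic remainder. -/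
theorem softPos_sub_le (hL : 0 < L) :
    softPos L (v - x) ≤ softPos L v - softPosDeriv L v * x + x ^ 2 / (4 * L) := by
  set r := √(v ^ 2 + L ^ 2) with hr
  have hrL : L ≤ r := le_sqrt_sq_add v
  have hr0 : 0 < r := hL.trans_le hrL
  have hr2 : r ^ 2 = v ^ 2 + L ^ 2 := Real.sq_sqrt (by positivity)
  have h1 : √((v - x) ^ 2 + L ^ 2) ≤ r + (x ^ 2 - 2 * v * x) / (2 * r) := by
    refine Real.sqrt_le_iff.2 ⟨?_, ?_⟩
    -- The tangent value is nonnegative because `2 r² + x² - 2 v x = v² + (v - x)² + 2 L²`.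
    · rw [← mul_le_mul_iff_of_pos_left (show 0 < 2 * r by linarith)]
      field_simp
      nlinarith [sq_nonneg (v - x), sq_nonneg L]
    · have : (r + (x ^ 2 - 2 * v * x) / (2 * r)) ^ 2 =
          r ^ 2 + (x ^ 2 - 2 * v * x) + ((x ^ 2 - 2 * v * x) / (2 * r)) ^ 2 := by
        field_simp
        ring
      rw [this, hr2]
      nlinarith [sq_nonneg ((x ^ 2 - 2 * v * x) / (2 * r))]
  have h2 : x ^ 2 / (4 * r) ≤ x ^ 2 / (4 * L) := by gcongr
  have h3 : (x ^ 2 - 2 * v * x) / (2 * r) = 2 * (x ^ 2 / (4 * r)) - v / r * x := by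
    field_simp
    ring
  unfold softPos softPosDeriv
  rw [← hr]
  linarith

theorem continuous_softPos : Continuous (softPos L) := by
  unfold softPos; fun_prop

theorem continuous_softPosDeriv (hL : 0 < L) : Continuous (softPosDeriv L) := by
  unfold softPosDeriv
  refine (continuous_const.add (continuous_id.div (by fun_prop) fun v => ?_)).div_const 2
  exact (hL.trans_le (le_sqrt_sq_add v)).ne'

end SoftPos

/-! ### Moments, divergences, and the one-step drift. -/

theorem PosKLFiniteSecondMoment.memLp {X : Type*} [MeasurableSpace X] {ν : Measure X}
    {g h : X → ℝ≥0} (H : PosKLFiniteSecondMoment ν g h) (hg : Measurable g) (hh : Measurable h) :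
    MemLp (fun x => Real.log ((g x : ℝ) / (h x : ℝ))) 2
      (ν.withDensity fun x => (g x : ℝ≥0∞)) := by
  have hm : Measurable fun x => Real.log ((g x : ℝ) / (h x : ℝ)) :=
    Real.measurable_log.comp (hg.coe_nnreal_real.div hh.coe_nnreal_real)
  rw [memLp_two_iff_integrable_sq hm.aestronglyMeasurable,
    ← lintegral_ofReal_ne_top_iff_integrable (hm.pow_const 2).aestronglyMeasurable
      (Filter.Eventually.of_forall fun x => sq_nonneg _),
    lintegral_withDensity_eq_lintegral_mul _ hg.coe_nnreal_ennreal (hm.pow_const 2).ennreal_ofReal]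
  -- Only an inequality: where `h` vanishes, the real logarithm takes its default value `0` while
  -- `sqLogRatio` is `⊤`.
  refine ne_top_of_le_ne_top H.2.ne (lintegral_mono fun x => ?_)
  simp only [Pi.mul_apply]
  rw [mul_comm]
  gcongr
  unfold sqLogRatio
  split_ifs
  · exact le_top
  · exact le_rfl

theorem PosKLFiniteSecondMoment.integral_pos {X : Type*} [MeasurableSpace X] {ν : Measure X}
    {g h : X → ℝ≥0} (H : PosKLFiniteSecondMoment ν g h) (hg : Measurable g) :
    0 < ∫ x, Real.log ((g x : ℝ) / (h x : ℝ)) ∂(ν.withDensity fun x => (g x : ℝ≥0∞)) := by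
  rw [integral_withDensity_eq_integral_smul hg]
  convert H.1 using 3
  rw [NNReal.smul_def, smul_eq_mul, mul_comm]

namespace StreamModel

variable {K : ℕ} {𝒳 : Fin K → Type*} [∀ k, MeasurableSpace (𝒳 k)] {M : StreamModel K 𝒳}

theorem law_of_mem {A : Finset (Fin K)} {k : Fin K} (h : k ∈ A) :
    M.law A k = (M.μ k).withDensity fun x => (M.f₁ k x : ℝ≥0∞) := by
  simp [law, h]

theorem law_of_notMem {A : Finset (Fin K)} {k : Fin K} (h : k ∉ A) :
    M.law A k = (M.μ k).withDensity fun x => (M.f₀ k x : ℝ≥0∞) := by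
  simp [law, h]

theorem logRatio_eq_neg (k : Fin K) :
    M.logRatio k = fun x => -Real.log ((M.f₀ k x : ℝ) / (M.f₁ k x : ℝ)) := by
  funext x
  rw [logRatio, ← Real.log_inv, inv_div]

theorem memLp_logRatio (hM : M.LLRMomentAssumption) (A : Finset (Fin K)) (k : Fin K) :
    MemLp (M.logRatio k) 2 (M.law A k) := by
  by_cases h : k ∈ A
  · rw [law_of_mem h]
    exact (hM k).1.memLp (M.measurable_f₁ k) (M.measurable_f₀ k)
  · rw [law_of_notMem h, logRatio_eq_neg]
    exact ((hM k).2.memLp (M.measurable_f₀ k) (M.measurable_f₁ k)).neg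

theorem integral_logRatio_pos (hM : M.LLRMomentAssumption) {A : Finset (Fin K)} {k : Fin K}
    (h : k ∈ A) : 0 < ∫ x, M.logRatio k x ∂(M.law A k) := by
  rw [law_of_mem h]
  exact (hM k).1.integral_pos (M.measurable_f₁ k)

theorem integral_logRatio_neg (hM : M.LLRMomentAssumption) {A : Finset (Fin K)} {k : Fin K}
    (h : k ∉ A) : ∫ x, M.logRatio k x ∂(M.law A k) < 0 := by
  rw [law_of_notMem h, logRatio_eq_neg, integral_neg, neg_lt_zero]
  exact (hM k).2.integral_pos (M.measurable_f₀ k)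

theorem memLp_logRatio_eval (hM : M.LLRMomentAssumption) (A : Finset (Fin K)) (k : Fin K) :
    MemLp (fun y : ∀ k, 𝒳 k => M.logRatio k (y k)) 2 (Measure.pi (M.law A)) :=
  (memLp_logRatio hM A k).comp_measurePreserving (measurePreserving_eval (M.law A) k)

theorem memLp_jointLogRatio (hM : M.LLRMomentAssumption) (A B : Finset (Fin K)) :
    MemLp (M.jointLogRatio A B) 2 (Measure.pi (M.law A)) :=
  memLp_finsetSum _ fun k _ => (memLp_logRatio_eval hM A k).const_mul _

/-- The Kullback-Leibler divergence of `ℙ_A` from `ℙ_B` for one observation of all streams. -/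
noncomputable def divergence (M : StreamModel K 𝒳) (A B : Finset (Fin K)) : ℝ :=
  ∫ y, M.jointLogRatio A B y ∂(Measure.pi (M.law A))

/-- By additivity the divergence is a sum of single-stream divergences over the streams where `A`
and `B` differ; each of them is positive and there is at least one. -/
theorem divergence_pos (hM : M.LLRMomentAssumption) {A B : Finset (Fin K)} (h : B ≠ A) :
    0 < M.divergence A B := by
  have h1 : M.divergence A B = ∑ k, diffSign A B k * ∫ x, M.logRatio k x ∂(M.law A k) := by
    unfold divergence jointLogRatio
    rw [integral_finsetSum _ fun k _ =>
      ((memLp_logRatio_eval hM A k).integrable (by norm_num)).const_mul _]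
    refine Finset.sum_congr rfl fun k _ => ?_
    rw [integral_const_mul]
    congr 1
    have hmp := measurePreserving_eval (M.law A) k
    rw [← hmp.map_eq, integral_map hmp.aemeasurable
      (M.measurable_logRatio k).aestronglyMeasurable]
  rw [h1]
  have h2 : ∀ k, 0 ≤ diffSign A B k * ∫ x, M.logRatio k x ∂(M.law A k) := by
    intro k
    by_cases hA : k ∈ A
    · have := integral_logRatio_pos hM hA
      by_cases hB : k ∈ B <;> simp [diffSign, hA, hB, this.le]
    · have := integral_logRatio_neg hM hA
      by_cases hB : k ∈ B <;> simp [diffSign, hA, hB, this.le]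
  obtain ⟨k, hk⟩ : ∃ k, ¬(k ∈ B ↔ k ∈ A) := by
    by_contra! hc
    exact h (Finset.ext hc)
  refine Finset.sum_pos' (fun k _ => h2 k) ⟨k, Finset.mem_univ _, ?_⟩
  by_cases hA : k ∈ A
  · have hB : k ∉ B := fun hB => hk ⟨fun _ => hA, fun _ => hB⟩
    simpa [diffSign, hA, hB] using integral_logRatio_pos hM hA
  · have hB : k ∈ B := by by_contra hB; exact hk ⟨fun h => absurd h hB, fun h => absurd h hA⟩
    simpa [diffSign, hA, hB] using integral_logRatio_neg hM hA

theorem measurePreserving_eval_P (M : StreamModel K 𝒳) (A : Finset (Fin K)) (n : ℕ) :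
    MeasurePreserving (fun ω : SamplePath K 𝒳 => ω n) (M.P A) (Measure.pi (M.law A)) := by
  unfold P
  exact measurePreserving_eval_infinitePi (fun _ : ℕ => Measure.pi (M.law A)) n

theorem indep_obsFiltration_eval (M : StreamModel K 𝒳) (A : Finset (Fin K)) (n : ℕ) :
    ProbabilityTheory.Indep (obsFiltration K 𝒳 n)
      (MeasurableSpace.comap (fun ω : SamplePath K 𝒳 => ω n) inferInstance) (M.P A) := by
  have h : ProbabilityTheory.iIndepFun (fun (s : ℕ) (ω : SamplePath K 𝒳) => ω s) (M.P A) := by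
    unfold P
    exact ProbabilityTheory.iIndepFun_infinitePi
      (P := fun _ : ℕ => Measure.pi (M.law A)) (X := fun _ y => y) fun _ => measurable_id
  have h1 := ProbabilityTheory.indep_iSup_of_disjoint (S := Set.Iio n) (T := {n})
    (fun s => (measurable_pi_apply s).comap_le) h.iIndep (by simp)
  simpa [obsFiltration] using h1

/-- The observation after time `n` is independent of the first `n` ones. -/
theorem integral_mul_eval (A : Finset (Fin K)) {n : ℕ} {g : SamplePath K 𝒳 → ℝ}
    (hg : Measurable[obsFiltration K 𝒳 n] g) {h : (∀ k, 𝒳 k) → ℝ} (hh : Measurable h) :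
    ∫ ω, g ω * h (ω n) ∂(M.P A) = (∫ ω, g ω ∂(M.P A)) * ∫ y, h y ∂(Measure.pi (M.law A)) := by
  have hmp := measurePreserving_eval_P M A n
  have hind : ProbabilityTheory.IndepFun g (fun ω : SamplePath K 𝒳 => h (ω n)) (M.P A) := by
    rw [ProbabilityTheory.IndepFun_iff_Indep]
    refine ProbabilityTheory.indep_of_indep_of_le_left
      (ProbabilityTheory.indep_of_indep_of_le_right (indep_obsFiltration_eval M A n) ?_)
      hg.comap_le
    have : (fun ω : SamplePath K 𝒳 => h (ω n)) = h ∘ fun ω => ω n := rfl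
    rw [this, ← MeasurableSpace.comap_comp]
    exact MeasurableSpace.comap_mono hh.comap_le
  have hg' : Measurable g := hg.mono ((obsFiltration K 𝒳).le n) le_rfl
  rw [hind.integral_fun_mul_eq_mul_integral hg'.aestronglyMeasurable
    (hh.comp (measurable_pi_apply n)).aestronglyMeasurable, ← hmp.map_eq,
    integral_map hmp.aemeasurable hh.aestronglyMeasurable]

theorem integrable_jointLLR (hM : M.LLRMomentAssumption) (A B : Finset (Fin K)) (n : ℕ) :
    Integrable (M.jointLLR A B n) (M.P A) :=
  integrable_finsetSum _ fun s _ => (measurePreserving_eval_P M A s).integrable_comp_of_integrable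
    ((memLp_jointLogRatio hM A B).integrable (by norm_num))

theorem integrable_softPos (hM : M.LLRMomentAssumption) (A B : Finset (Fin K)) (n : ℕ) {L : ℝ}
    (hL : 0 < L) (a : ℝ) :
    Integrable (fun ω => softPos L (a - M.jointLLR A B n ω)) (M.P A) := by
  have h1 : Integrable (fun ω => |a - M.jointLLR A B n ω| + L) (M.P A) :=
    (((integrable_const a).sub (integrable_jointLLR hM A B n)).abs).add (integrable_const L)
  refine h1.mono' (continuous_softPos.measurable.comp
    (measurable_const.sub (M.measurable_jointLLR A B n))).aestronglyMeasurable ?_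
  refine Filter.Eventually.of_forall fun ω => ?_
  rw [Real.norm_of_nonneg (softPos_nonneg _)]
  exact (softPos_le _ hL).trans (add_le_add_left (max_le (le_abs_self _) (abs_nonneg _)) L)

/-- One step of the drift inequality. -/
theorem setIntegral_softPos_succ_le (hM : M.LLRMomentAssumption) (A B : Finset (Fin K)) {n : ℕ}
    {L : ℝ} (hL : 0 < L) (a : ℝ) {E : Set (SamplePath K 𝒳)}
    (hE : MeasurableSet[obsFiltration K 𝒳 n] E) :
    ∫ ω in E, softPos L (a - M.jointLLR A B (n + 1) ω) ∂(M.P A) ≤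
      ∫ ω in E, softPos L (a - M.jointLLR A B n ω) ∂(M.P A) -
        M.divergence A B * ∫ ω in E, softPosDeriv L (a - M.jointLLR A B n ω) ∂(M.P A) +
        (∫ y, M.jointLogRatio A B y ^ 2 ∂(Measure.pi (M.law A))) / (4 * L) * (M.P A).real E := by
  have hE' : MeasurableSet E := (obsFiltration K 𝒳).le n _ hE
  have hZ := M.measurable_jointLLR_obsFiltration A B n
  have hmp := measurePreserving_eval_P M A n
  set φ : SamplePath K 𝒳 → ℝ := fun ω => softPos L (a - M.jointLLR A B n ω) with hφ
  set ψ : SamplePath K 𝒳 → ℝ := fun ω => softPosDeriv L (a - M.jointLLR A B n ω) with hψ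
  set X : SamplePath K 𝒳 → ℝ := fun ω => M.jointLogRatio A B (ω n) with hX
  have hψm : Measurable[obsFiltration K 𝒳 n] ψ :=
    (continuous_softPosDeriv hL).measurable.comp (measurable_const.sub hZ)
  have hψm' : Measurable ψ := hψm.mono ((obsFiltration K 𝒳).le n) le_rfl
  have hXi : Integrable X (M.P A) := hmp.integrable_comp_of_integrable
    ((memLp_jointLogRatio hM A B).integrable (by norm_num))
  have hX2 : Integrable (fun ω => X ω ^ 2) (M.P A) := hmp.integrable_comp_of_integrable
    (memLp_jointLogRatio hM A B).integrable_sq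
  have hφi : Integrable φ (M.P A) := integrable_softPos hM A B n hL a
  have hψX : Integrable (fun ω => ψ ω * X ω) (M.P A) := by
    refine hXi.bdd_mul (c := 1) hψm'.aestronglyMeasurable
      (Filter.Eventually.of_forall fun ω => ?_)
    rw [Real.norm_of_nonneg (softPosDeriv_nonneg _)]
    exact softPosDeriv_le_one _
  -- The indicator of `E` times `ψ` depends on the first `n` observations only, so the next
  -- increment factors out and contributes its mean.
  have e1 : ∫ ω in E, ψ ω * X ω ∂(M.P A) = (∫ ω in E, ψ ω ∂(M.P A)) * M.divergence A B := by
    rw [← integral_indicator hE', ← integral_indicator hE', divergence,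
      ← integral_mul_eval A (hψm.indicator hE) (M.measurable_jointLogRatio A B)]
    refine integral_congr_ae (Filter.Eventually.of_forall fun ω => ?_)
    by_cases hω : ω ∈ E <;> simp [hω, hX]
  have e2 : ∫ ω in E, X ω ^ 2 ∂(M.P A) =
      (M.P A).real E * ∫ y, M.jointLogRatio A B y ^ 2 ∂(Measure.pi (M.law A)) := by
    have h0 : Measurable[obsFiltration K 𝒳 n] fun _ : SamplePath K 𝒳 => (1 : ℝ) :=
      measurable_const
    have h1 : Measurable[obsFiltration K 𝒳 n] (E.indicator (1 : SamplePath K 𝒳 → ℝ)) :=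
      h0.indicator hE
    rw [← integral_indicator hE', ← integral_indicator_one hE',
      ← integral_mul_eval (M := M) A h1 ((M.measurable_jointLogRatio A B).pow_const 2)]
    refine integral_congr_ae (Filter.Eventually.of_forall fun ω => ?_)
    by_cases hω : ω ∈ E <;> simp [hω, hX]
  calc ∫ ω in E, softPos L (a - M.jointLLR A B (n + 1) ω) ∂(M.P A)
      ≤ ∫ ω in E, (φ ω - ψ ω * X ω + X ω ^ 2 / (4 * L)) ∂(M.P A) := by
        refine integral_mono (integrable_softPos hM A B (n + 1) hL a).integrableOn
          ((hφi.sub hψX).add (hX2.div_const _)).integrableOn fun ω => ?_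
        have : a - M.jointLLR A B (n + 1) ω = a - M.jointLLR A B n ω - X ω := by
          simp only [jointLLR, Finset.sum_range_succ, hX]; ring
        simp only [this]
        exact softPos_sub_le _ _ hL
    _ = _ := by
        rw [integral_add (f := fun ω => φ ω - ψ ω * X ω) (hφi.sub hψX).integrableOn
          (hX2.div_const _).integrableOn, integral_sub hφi.integrableOn hψX.integrableOn, integral_div, e1, e2]
        ring

end StreamModel

/-! ### Lyapunov drift and expected excursion times. -/

namespace StreamModel

variable {K : ℕ} {𝒳 : Fin K → Type*} [∀ k, MeasurableSpace (𝒳 k)] {M : StreamModel K 𝒳}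

/-- The drift of the sum of the potentials, as long as one of the log-likelihood ratios is below
the level `a`. -/
theorem exists_drift (hM : M.LLRMomentAssumption) (A : Finset (Fin K)) :
    ∃ L c : ℝ, 0 < L ∧ 0 < c ∧ ∀ (Bs : Finset (Finset (Fin K))), A ∉ Bs → ∀ (a : ℝ) (n : ℕ)
      (E : Set (SamplePath K 𝒳)), MeasurableSet[obsFiltration K 𝒳 n] E →
      (∀ ω ∈ E, ∃ B ∈ Bs, M.jointLLR A B n ω < a) →
      ∑ B ∈ Bs, ∫ ω in E, softPos L (a - M.jointLLR A B (n + 1) ω) ∂(M.P A) +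
        c * (M.P A).real E ≤
      ∑ B ∈ Bs, ∫ ω in E, softPos L (a - M.jointLLR A B n ω) ∂(M.P A) := by
  -- A common lower bound of the drifts: the smallest divergence over the finitely many `B ≠ A`, or
  -- an arbitrary positive number if there are none.
  obtain ⟨μ, hμ, hμB⟩ : ∃ μ : ℝ, 0 < μ ∧ ∀ B, B ≠ A → μ ≤ M.divergence A B := by
    by_cases hne : (Finset.univ.erase A).Nonempty
    · obtain ⟨B₀, h₀, hmin⟩ := Finset.exists_min_image _ (M.divergence A) hne
      exact ⟨M.divergence A B₀, divergence_pos hM (Finset.ne_of_mem_erase h₀),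
        fun B hB => hmin B (Finset.mem_erase.2 ⟨hB, Finset.mem_univ _⟩)⟩
    · refine ⟨1, one_pos, fun B hB => absurd ?_ hne⟩
      exact ⟨B, Finset.mem_erase.2 ⟨hB, Finset.mem_univ _⟩⟩
  set q : Finset (Fin K) → ℝ := fun B =>
    ∫ y, M.jointLogRatio A B y ^ 2 ∂(Measure.pi (M.law A)) with hq
  have hq0 : ∀ B, 0 ≤ q B := fun B => integral_nonneg fun y => sq_nonneg _
  have hQ0 : 0 ≤ ∑ B, q B := Finset.sum_nonneg fun B _ => hq0 B
  -- The guaranteed decrease is `μ / 2`. This choice of `L` keeps the sum of the second-order terms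
  -- `q B / (4 L)` below `μ / 4`, which leaves a net drift `c = μ / 4`; the `+ 1` makes `L`
  -- positive.
  set L : ℝ := (∑ B, q B + 1) / μ with hLdef
  have hL : 0 < L := by positivity
  refine ⟨L, μ / 4, hL, by positivity, fun Bs hBs a n E hE hlow => ?_⟩
  have hE' : MeasurableSet E := (obsFiltration K 𝒳).le n _ hE
  set ψ : Finset (Fin K) → SamplePath K 𝒳 → ℝ := fun B ω =>
    softPosDeriv L (a - M.jointLLR A B n ω) with hψ
  have hψi : ∀ B, Integrable (ψ B) (M.P A) := fun B => by
    refine (integrable_const (1 : ℝ)).mono' ((continuous_softPosDeriv hL).measurable.comp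
      (measurable_const.sub (M.measurable_jointLLR A B n))).aestronglyMeasurable
      (Filter.Eventually.of_forall fun ω => ?_)
    rw [Real.norm_of_nonneg (softPosDeriv_nonneg _)]
    exact softPosDeriv_le_one _
  have h1 : ∀ B ∈ Bs, ∫ ω in E, softPos L (a - M.jointLLR A B (n + 1) ω) ∂(M.P A) ≤
      ∫ ω in E, softPos L (a - M.jointLLR A B n ω) ∂(M.P A) - μ * ∫ ω in E, ψ B ω ∂(M.P A) +
        q B / (4 * L) * (M.P A).real E := by
    intro B hB
    refine (setIntegral_softPos_succ_le hM A B hL a hE).trans ?_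
    have : 0 ≤ ∫ ω in E, ψ B ω ∂(M.P A) := integral_nonneg fun ω => softPosDeriv_nonneg _
    have := mul_le_mul_of_nonneg_right (hμB B fun h => hBs (h ▸ hB)) this
    simp only [hψ] at this ⊢
    linarith
  -- On `E` some walk is below the level, and its potential has slope at least `1 / 2`; the other
  -- slopes are nonnegative. Walks already above the level therefore cannot spoil the drift.
  have h2 : (M.P A).real E / 2 ≤ ∑ B ∈ Bs, ∫ ω in E, ψ B ω ∂(M.P A) := by
    rw [← integral_finsetSum _ fun B _ => (hψi B).integrableOn]
    have : (M.P A).real E / 2 = ∫ _ in E, (1 / 2 : ℝ) ∂(M.P A) := by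
      rw [setIntegral_const, smul_eq_mul]; ring
    rw [this]
    refine setIntegral_mono_on (integrable_const _).integrableOn
      (integrable_finsetSum _ fun B _ => hψi B).integrableOn hE' fun ω hω => ?_
    obtain ⟨B, hB, hlt⟩ := hlow ω hω
    exact (half_le_softPosDeriv (by linarith)).trans
      (Finset.single_le_sum (f := fun B => ψ B ω) (fun B _ => softPosDeriv_nonneg _) hB)
  have h3 : ∑ B ∈ Bs, q B / (4 * L) * (M.P A).real E ≤ μ / 4 * (M.P A).real E := by
    rw [← Finset.sum_mul, ← Finset.sum_div]
    refine mul_le_mul_of_nonneg_right ?_ measureReal_nonneg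
    rw [div_le_iff₀ (by positivity), hLdef]
    have : ∑ B ∈ Bs, q B ≤ ∑ B, q B :=
      Finset.sum_le_sum_of_subset_of_nonneg (Finset.subset_univ _) fun B _ _ => hq0 B
    have e : μ / 4 * (4 * ((∑ B, q B + 1) / μ)) = ∑ B, q B + 1 := by field_simp
    linarith
  have h4 := Finset.sum_le_sum h1
  rw [Finset.sum_add_distrib, Finset.sum_sub_distrib, ← Finset.mul_sum] at h4
  nlinarith [mul_le_mul_of_nonneg_left h2 hμ.le]

/-- The expected time that is spent, after time `n` and on the event `E 0`, before all the
log-likelihood ratios of `ℙ_A` against the `ℙ_B` are at least `a`. -/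
theorem exists_excursion_bound (hM : M.LLRMomentAssumption) (A : Finset (Fin K)) :
    ∃ L c : ℝ, 0 < L ∧ 0 < c ∧ ∀ (Bs : Finset (Finset (Fin K))), A ∉ Bs → ∀ (a : ℝ) (n : ℕ)
      (E : ℕ → Set (SamplePath K 𝒳)), (∀ j, MeasurableSet[obsFiltration K 𝒳 (n + j)] (E j)) →
      Antitone E → (∀ j, ∀ ω ∈ E j, ∃ B ∈ Bs, M.jointLLR A B (n + j) ω < a) →
      ENNReal.ofReal c * ∑' j, M.P A (E j) ≤
        ∑ B ∈ Bs, ∫⁻ ω in E 0, ENNReal.ofReal (max (a - M.jointLLR A B n ω) 0 + L) ∂(M.P A) := by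
  obtain ⟨L, c, hL, hc, H⟩ := exists_drift hM A
  refine ⟨L, c, hL, hc, fun Bs hBs a n E hE hanti hlow => ?_⟩
  have hE' : ∀ j, MeasurableSet (E j) := fun j => (obsFiltration K 𝒳).le _ _ (hE j)
  set V : ℕ → ℕ → ℝ := fun i j =>
    ∑ B ∈ Bs, ∫ ω in E i, softPos L (a - M.jointLLR A B (n + j) ω) ∂(M.P A) with hV
  have hV0 : ∀ i j, 0 ≤ V i j := fun i j =>
    Finset.sum_nonneg fun B _ => integral_nonneg fun ω => softPos_nonneg _
  -- Telescoping. Passing from `E N` to the smaller `E (N + 1)` only discards nonnegative mass.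
  have hsum : ∀ N, V N N + c * ∑ j ∈ Finset.range N, (M.P A).real (E j) ≤ V 0 0 := by
    intro N
    induction N with
    | zero => simp
    | succ N ih =>
      have h1 : V N (N + 1) + c * (M.P A).real (E N) ≤ V N N := H Bs hBs a (n + N) (E N) (hE N)
        (hlow N)
      have h2 : V (N + 1) (N + 1) ≤ V N (N + 1) := by
        refine Finset.sum_le_sum fun B _ => setIntegral_mono_set
          (integrable_softPos hM A B _ hL a).integrableOn
          (Filter.Eventually.of_forall fun ω => softPos_nonneg _)
          (hanti (Nat.le_succ N)).eventuallyLE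
      rw [Finset.sum_range_succ, mul_add]
      linarith
  have h1 : ENNReal.ofReal c * ∑' j, M.P A (E j) ≤ ENNReal.ofReal (V 0 0) := by
    rw [← ENNReal.tsum_mul_left, ENNReal.tsum_eq_iSup_nat]
    refine iSup_le fun N => ?_
    have : ∑ j ∈ Finset.range N, ENNReal.ofReal c * M.P A (E j) =
        ENNReal.ofReal (c * ∑ j ∈ Finset.range N, (M.P A).real (E j)) := by
      rw [Finset.mul_sum, ENNReal.ofReal_sum_of_nonneg fun j _ => by positivity]
      refine Finset.sum_congr rfl fun j _ => ?_
      rw [ENNReal.ofReal_mul hc.le, ofReal_measureReal]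
    rw [this]
    exact ENNReal.ofReal_le_ofReal (by linarith [hsum N, hV0 N N])
  refine h1.trans ?_
  rw [hV]
  simp only [add_zero]
  rw [ENNReal.ofReal_sum_of_nonneg fun B _ => integral_nonneg fun ω => softPos_nonneg _]
  refine Finset.sum_le_sum fun B _ => ?_
  rw [ofReal_integral_eq_lintegral_ofReal (integrable_softPos hM A B n hL a).integrableOn
    (Filter.Eventually.of_forall fun ω => softPos_nonneg _)]
  exact lintegral_mono fun ω => ENNReal.ofReal_le_ofReal (softPos_le _ hL)

/-- Uses `v⁺ ≤ exp v` and the change of measure. Sharp enough when `E` has probability of order `exp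
(-a)` under `ℙ_B`, as for an erroneous decision at `B`. -/
theorem setLIntegral_deficit_le_exp (hM : M.LLRMomentAssumption) (A B : Finset (Fin K)) {n : ℕ}
    {L a : ℝ} (hL : 0 ≤ L) {E : Set (SamplePath K 𝒳)}
    (hE : MeasurableSet[obsFiltration K 𝒳 n] E) :
    ∫⁻ ω in E, ENNReal.ofReal (max (a - M.jointLLR A B n ω) 0 + L) ∂(M.P A) ≤
      ENNReal.ofReal (Real.exp a) * M.P B E + ENNReal.ofReal L * M.P A E := by
  rw [← setLIntegral_exp_neg_jointLLR hM A B hE, ← lintegral_const_mul' _ _ (by simp),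
    ← setLIntegral_const, ← lintegral_add_right _ measurable_const]
  refine lintegral_mono fun ω => ?_
  rw [← ENNReal.ofReal_mul (Real.exp_pos _).le, ← Real.exp_add,
    ← ENNReal.ofReal_add (Real.exp_pos _).le hL]
  refine ENNReal.ofReal_le_ofReal (add_le_add_left (max_le ?_ (Real.exp_pos _).le) L)
  linarith [Real.add_one_le_exp (a + -M.jointLLR A B n ω)]

/-- Uses `(a - z)⁺ ≤ a + exp (-z)`, so that `ℙ_B` carries no exponential factor. Meant for events
that are rare under `ℙ_A`, and for finiteness of the expected sample size. -/
theorem setLIntegral_deficit_le_add (hM : M.LLRMomentAssumption) (A B : Finset (Fin K)) {n : ℕ}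
    {L a : ℝ} (hL : 0 ≤ L) (ha : 0 ≤ a) {E : Set (SamplePath K 𝒳)}
    (hE : MeasurableSet[obsFiltration K 𝒳 n] E) :
    ∫⁻ ω in E, ENNReal.ofReal (max (a - M.jointLLR A B n ω) 0 + L) ∂(M.P A) ≤
      M.P B E + ENNReal.ofReal (a + L) * M.P A E := by
  rw [← setLIntegral_exp_neg_jointLLR hM A B hE, ← setLIntegral_const,
    ← lintegral_add_right _ measurable_const]
  refine lintegral_mono fun ω => ?_
  rw [← ENNReal.ofReal_add (Real.exp_pos _).le (by positivity)]
  refine ENNReal.ofReal_le_ofReal ?_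
  have h := Real.add_one_le_exp (-M.jointLLR A B n ω)
  have h' := Real.exp_pos (-M.jointLLR A B n ω)
  rw [← add_assoc]
  exact add_le_add_left (max_le (by linarith) (by linarith)) L

end StreamModel

/-! ### Combinatorics of the ordered sums. -/

/-- Exchange argument: the common part cancels, and the minimum of `f` over `W \ S` separates what
remains. -/
theorem Finset.sum_le_sum_of_card_le {ι : Type*} [DecidableEq ι] {f : ι → ℝ≥0∞} {S W : Finset ι}
    (hc : S.card ≤ W.card) (h : ∀ s ∈ S \ W, ∀ w ∈ W \ S, f s ≤ f w) :
    ∑ s ∈ S, f s ≤ ∑ w ∈ W, f w := by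
  have hc' : (S \ W).card ≤ (W \ S).card := Finset.card_sdiff_le_card_sdiff_iff.2 hc
  have hd : ∑ s ∈ S \ W, f s ≤ ∑ w ∈ W \ S, f w := by
    rcases (W \ S).eq_empty_or_nonempty with he | hne
    · have : S \ W = ∅ := by
        rw [he, Finset.card_empty] at hc'
        exact Finset.card_eq_zero.1 (Nat.le_zero.1 hc')
      simp [this]
    · obtain ⟨w₀, hw₀, hmin⟩ := Finset.exists_min_image _ f hne
      calc ∑ s ∈ S \ W, f s ≤ (S \ W).card • f w₀ :=
            Finset.sum_le_card_nsmul _ _ _ fun s hs => h s hs w₀ hw₀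
        _ ≤ (W \ S).card • f w₀ := nsmul_le_nsmul_left zero_le hc'
        _ ≤ ∑ w ∈ W \ S, f w := Finset.card_nsmul_le_sum _ _ _ hmin
  calc ∑ s ∈ S, f s = ∑ s ∈ S ∩ W, f s + ∑ s ∈ S \ W, f s :=
        (Finset.sum_inter_add_sum_sdiff S W f).symm
    _ ≤ ∑ s ∈ W ∩ S, f s + ∑ w ∈ W \ S, f w := by
        rw [Finset.inter_comm]; gcongr
    _ = ∑ w ∈ W, f w := Finset.sum_inter_add_sum_sdiff W S f

/-- The absolute value of `x k` as an extended nonnegative number. -/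
noncomputable def eabs {K : ℕ} (x : Fin K → ℝ) (k : Fin K) : ℝ≥0∞ := ENNReal.ofReal |x k|

section OrderStat

variable {K : ℕ} {x : Fin K → ℝ} {l : List (Fin K)}

theorem orderStatSum_zero (i : ℕ) : orderStatSum x l i 0 = 0 := by
  simp [orderStatSum]

theorem orderStatSum_succ (i n : ℕ) :
    orderStatSum x l i (n + 1) = orderStatSum x l i n + orderStat x l (i + n + 1) := by
  unfold orderStatSum
  rw [← add_assoc, Finset.sum_Icc_succ_top (by omega)]

theorem orderStatSum_eq_sum (hl : l.Nodup) {i n : ℕ} (h : i + n ≤ l.length) :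
    orderStatSum x l i n = ∑ k ∈ ((l.drop i).take n).toFinset, eabs x k := by
  have hnd : ((l.drop i).take n).Nodup :=
    hl.sublist ((List.take_sublist _ _).trans (List.drop_sublist _ _))
  rw [List.sum_toFinset _ hnd]
  clear hnd
  induction n with
  | zero => simp [orderStatSum_zero]
  | succ n ih =>
    have hlt : n < (l.drop i).length := by simp; omega
    rw [orderStatSum_succ, ih (by omega), List.take_succ_eq_append_getElem hlt]
    have hs : l[i + n]? = some l[i + n] := List.getElem?_eq_getElem (by omega)
    simp [orderStat, hs, eabs]

theorem orderStatSum_eq_top {i n : ℕ} (hn : 0 < n) (h : l.length < i + n) :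
    orderStatSum x l i n = ⊤ := by
  obtain ⟨n, rfl⟩ : ∃ k, n = k + 1 := ⟨n - 1, by omega⟩
  have hs : l[i + n]? = none := List.getElem?_eq_none (by omega)
  simp [orderStatSum_succ, orderStat, hs]

theorem card_window (hl : l.Nodup) {i n : ℕ} (h : i + n ≤ l.length) :
    ((l.drop i).take n).toFinset.card = n := by
  rw [List.toFinset_card_of_nodup
    (hl.sublist ((List.take_sublist _ _).trans (List.drop_sublist _ _)))]
  simp; omega

/-- The window consists of the `n` smallest entries after the first `i`, so no `n` other streams
from that range can have a smaller sum. -/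
theorem orderStatSum_le_sum (hl : l.Nodup) (hs : l.Pairwise fun j k => |x j| ≤ |x k|) {i n : ℕ}
    {S : Finset (Fin K)} (hS : S ⊆ (l.drop i).toFinset) (hn : n ≤ S.card) :
    orderStatSum x l i n ≤ ∑ k ∈ S, eabs x k := by
  rcases Nat.eq_zero_or_pos n with rfl | hpos
  · simp [orderStatSum_zero]
  have hlen : i + n ≤ l.length := by
    have h1 := (Finset.card_le_card hS).trans (List.toFinset_card_le _)
    rw [List.length_drop] at h1
    omega
  rw [orderStatSum_eq_sum hl hlen]
  refine Finset.sum_le_sum_of_card_le ((card_window hl hlen).trans_le hn) fun w hw s hs' => ?_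
  rw [Finset.mem_sdiff, List.mem_toFinset] at hw hs'
  have hs1 : s ∈ l.drop i := List.mem_toFinset.1 (hS hs'.1)
  have hd : (l.drop i).Pairwise fun j k => |x j| ≤ |x k| := hs.sublist (List.drop_sublist _ _)
  rw [← List.take_append_drop n (l.drop i), List.pairwise_append] at hd
  rw [← List.take_append_drop n (l.drop i), List.mem_append] at hs1
  exact ENNReal.ofReal_le_ofReal (hd.2.2 w hw.1 s (hs1.resolve_left hs'.2))

/-- Dual to `orderStatSum_le_sum`: the window consists of the `n` largest among the first `i + n`
entries. -/
theorem sum_le_orderStatSum (hl : l.Nodup) (hs : l.Pairwise fun j k => |x j| ≤ |x k|) {i n : ℕ}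
    {S : Finset (Fin K)} (hS : S ⊆ (l.take (i + n)).toFinset) (hn : S.card ≤ n) :
    ∑ k ∈ S, eabs x k ≤ orderStatSum x l i n := by
  rcases Nat.eq_zero_or_pos n with rfl | hpos
  · simp [Finset.card_eq_zero.1 (Nat.le_zero.1 hn)]
  rcases lt_or_ge l.length (i + n) with hlen | hlen
  · rw [orderStatSum_eq_top hpos hlen]; exact le_top
  rw [orderStatSum_eq_sum hl hlen]
  refine Finset.sum_le_sum_of_card_le (hn.trans_eq (card_window hl hlen).symm) fun s hs' w hw => ?_
  rw [Finset.mem_sdiff, List.mem_toFinset] at hw hs'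
  have hs1 : s ∈ l.take (i + n) := List.mem_toFinset.1 (hS hs'.1)
  rw [List.take_add, List.mem_append] at hs1
  rw [← List.take_append_drop i l, List.pairwise_append] at hs
  exact ENNReal.ofReal_le_ofReal
    (hs.2.2 s (hs1.resolve_right hs'.2) w (List.mem_of_mem_take hw.1))

/-- If the decision `D` is such that moving to any parameter that is far from `D` costs at least
`b` or `a`, then the ordered sums exceed these levels. The list `l` ranks the streams of one sign
and `l'` those of the other sign. -/
theorem le_orderStatSum_of_forall_subset {l' : List (Fin K)} (hl : l.Nodup) (hl' : l'.Nodup)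
    (hs' : l'.Pairwise fun j k => |x j| ≤ |x k|)
    (hdisj : Disjoint l.toFinset l'.toFinset) {D : Finset (Fin K)} {m m' : ℕ} {a b : ℝ≥0∞}
    (h : ∀ S ⊆ l.toFinset, m ≤ (D \ l.toFinset).card + (S ∩ D).card → b ≤ ∑ k ∈ S, eabs x k)
    (h' : ∀ S ⊆ l'.toFinset, m' ≤ (l.toFinset \ D).card + (S \ D).card → a ≤ ∑ k ∈ S, eabs x k)
    (hle : (l.toFinset \ D).card ≤ (D \ l.toFinset).card)
    (hm' : 0 < m') :
    b ≤ orderStatSum x l 0 (m - ((D \ l.toFinset).card - (l.toFinset \ D).card)) ∧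
      a ≤ orderStatSum x l' ((D \ l.toFinset).card - (l.toFinset \ D).card) m' := by
  set p := (l.toFinset \ D).card with hp
  set q := (D \ l.toFinset).card with hq
  constructor
  · rcases lt_or_ge l.length (0 + (m - (q - p))) with hlen | hlen
    · rw [orderStatSum_eq_top (by omega) hlen]; exact le_top
    · rw [orderStatSum_eq_sum hl hlen]
      -- At most `p` of these `m - (q - p)` streams lie outside `D`, so at least `m - q` lie in `D`;
      -- together with the `q` streams of `D` outside `l` they make `m` errors.
      set W := ((l.drop 0).take (m - (q - p))).toFinset with hW
      have hWc : W.card = m - (q - p) := card_window hl hlen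
      have hsub : W ⊆ l.toFinset := fun k hk => by
        rw [hW, List.mem_toFinset] at hk
        exact List.mem_toFinset.2 (List.mem_of_mem_drop (List.mem_of_mem_take hk))
      refine h W hsub ?_
      have h1 : (W \ D).card ≤ p := Finset.card_le_card (Finset.sdiff_subset_sdiff hsub le_rfl)
      have h2 := Finset.card_inter_add_card_sdiff W D
      omega
  · rcases lt_or_ge l'.length ((q - p) + m') with hlen | hlen
    · rw [orderStatSum_eq_top hm' hlen]; exact le_top
    -- At most `q` of these `q - p + m'` streams lie in `D`, so `m' - p` of them can be selected
    -- outside `D`; with the `p` streams of `l` missed by `D` they make `m'` errors.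
    · set W := (l'.take (q - p + m')).toFinset with hW
      have hWc : W.card = q - p + m' := by
        have := card_window (i := 0) hl' (by simpa using hlen)
        simpa [hW] using this
      have hsub : W ⊆ l'.toFinset := fun k hk => by
        rw [hW, List.mem_toFinset] at hk
        exact List.mem_toFinset.2 (List.mem_of_mem_take hk)
      have h1 : (W ∩ D).card ≤ q := Finset.card_le_card fun k hk => by
        rw [Finset.mem_inter] at hk
        exact Finset.mem_sdiff.2 ⟨hk.2, Finset.disjoint_right.1 hdisj (hsub hk.1)⟩
      have h2 := Finset.card_inter_add_card_sdiff W D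
      obtain ⟨S, hS, hSc⟩ := Finset.exists_subset_card_eq (show m' - p ≤ (W \ D).card by omega)
      have hSD : S \ D = S := Finset.sdiff_eq_self_of_disjoint
        (Finset.disjoint_left.2 fun k hk => (Finset.mem_sdiff.1 (hS hk)).2)
      refine (h' S ((hS.trans Finset.sdiff_subset).trans hsub) ?_).trans
        (sum_le_orderStatSum hl' hs' (hS.trans Finset.sdiff_subset) (by omega))
      rw [hSD, hSc]; omega

/-- The appended streams account for at most `i` of the `m` errors; the other `m - i` lie in `l` and
cost at least its `m - i` smallest values. With the signs exchanged, this serves both false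
positives of `D̂_i` and false negatives of `Ď_i`. -/
theorem exists_subset_of_le_card_union (hl : l.Nodup)
    (hs : l.Pairwise fun j k => |x j| ≤ |x k|) {l' : List (Fin K)} {X : Finset (Fin K)} {i m : ℕ}
    (hi : i < m) (h : m ≤ ((l.toFinset ∪ (l'.take i).toFinset) ∩ X).card) :
    ∃ S ⊆ l.toFinset ∩ X, S.Nonempty ∧ S.card ≤ m ∧
      orderStatSum x l 0 (m - i) ≤ ∑ k ∈ S, eabs x k := by
  have h1 : (l'.take i).toFinset.card ≤ i :=
    (List.toFinset_card_le _).trans (List.length_take_le _ _)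
  have h2 : ((l.toFinset ∪ (l'.take i).toFinset) ∩ X).card ≤
      (l.toFinset ∩ X).card + (l'.take i).toFinset.card := by
    rw [Finset.union_inter_distrib_right]
    exact (Finset.card_union_le _ _).trans
      (Nat.add_le_add_left (Finset.card_le_card Finset.inter_subset_left) _)
  obtain ⟨S, hS, hSc⟩ := Finset.exists_subset_card_eq (show m - i ≤ (l.toFinset ∩ X).card by omega)
  refine ⟨S, hS, Finset.card_pos.1 (by omega), by omega, orderStatSum_le_sum hl hs ?_ hSc.ge⟩
  simpa using hS.trans Finset.inter_subset_left

/-- The errors avoid the `i` least significant entries of `l`, so any `m` of them cost at least the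
window that follows these entries. -/
theorem exists_subset_of_le_card_sdiff (hl : l.Nodup)
    (hs : l.Pairwise fun j k => |x j| ≤ |x k|) {X : Finset (Fin K)} {i m : ℕ}
    (hm : 0 < m) (h : m ≤ ((l.toFinset \ (l.take i).toFinset) ∩ X).card) :
    ∃ S ⊆ l.toFinset ∩ X, S.Nonempty ∧ S.card ≤ m ∧
      orderStatSum x l i m ≤ ∑ k ∈ S, eabs x k := by
  obtain ⟨S, hS, hSc⟩ := Finset.exists_subset_card_eq h
  refine ⟨S, hS.trans (Finset.inter_subset_inter_right Finset.sdiff_subset),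
    Finset.card_pos.1 (by omega), hSc.le, orderStatSum_le_sum hl hs (fun k hk => ?_) hSc.ge⟩
  have h1 := (Finset.mem_sdiff.1 (Finset.mem_inter.1 (hS hk)).1)
  rw [List.mem_toFinset, List.mem_toFinset] at h1
  have h2 := h1.1
  rw [← List.take_append_drop i l, List.mem_append] at h2
  exact List.mem_toFinset.2 (h2.resolve_left h1.2)

end OrderStat

namespace EvidenceOrder

variable {K : ℕ} (o : EvidenceOrder K) (x : Fin K → ℝ)

theorem nodup_ofFn : (List.ofFn (o.perm x)).Nodup :=
  List.nodup_ofFn.2 (o.perm x).injective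

theorem pairwise_ofFn : (List.ofFn (o.perm x)).Pairwise fun j k => |x j| ≤ |x k| :=
  List.pairwise_ofFn.2 fun _ _ h => o.sorted x h.le

theorem nodup_posList : (o.posList x).Nodup := (o.nodup_ofFn x).filter _

theorem nodup_negList : (o.negList x).Nodup := (o.nodup_ofFn x).filter _

theorem pairwise_posList : (o.posList x).Pairwise fun j k => |x j| ≤ |x k| :=
  (o.pairwise_ofFn x).filter _

theorem pairwise_negList : (o.negList x).Pairwise fun j k => |x j| ≤ |x k| :=
  (o.pairwise_ofFn x).filter _

theorem mem_posList {k : Fin K} : k ∈ o.posList x ↔ 0 < x k := by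
  simp only [posList, List.mem_filter, List.mem_ofFn, decide_eq_true_eq, and_iff_right_iff_imp]
  exact fun _ => (o.perm x).surjective k

theorem mem_negList {k : Fin K} : k ∈ o.negList x ↔ x k ≤ 0 := by
  simp only [negList, List.mem_filter, List.mem_ofFn, decide_eq_true_eq, and_iff_right_iff_imp]
  exact fun _ => (o.perm x).surjective k

theorem negList_toFinset : (o.negList x).toFinset = (o.posList x).toFinsetᶜ := by
  ext k
  simp [mem_posList, mem_negList]

theorem filter_pos_eq : (Finset.univ.filter fun k => 0 < x k) = (o.posList x).toFinset := by
  ext k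
  simp [mem_posList]

end EvidenceOrder

/-! ### First passage times. -/

theorem one_le_firstTime (p : ℕ → Prop) : 1 ≤ firstTime p :=
  le_iInf₂ fun t ht => by exact_mod_cast ht.1

theorem firstTime_le {p : ℕ → Prop} {t : ℕ} (h1 : 1 ≤ t) (h : p t) : firstTime p ≤ t :=
  iInf₂_le t ⟨h1, h⟩

theorem firstTime_anti {p q : ℕ → Prop} (h : ∀ t, p t → q t) : firstTime q ≤ firstTime p :=
  le_iInf₂ fun t ht => firstTime_le ht.1 (h t ht.2)

theorem firstTime_le_iff {p : ℕ → Prop} {n : ℕ} :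
    firstTime p ≤ n ↔ ∃ t, t ≤ n ∧ 1 ≤ t ∧ p t := by
  refine ⟨fun h => ?_, fun ⟨t, htn, h1, ht⟩ =>
    (firstTime_le h1 ht).trans (by exact_mod_cast htn)⟩
  by_contra! hc
  have h1 : ((n + 1 : ℕ) : ℕ∞) ≤ firstTime p := le_iInf₂ fun t ht => by
    by_contra! hlt
    have : t < n + 1 := by exact_mod_cast hlt
    exact hc t (by omega) ht.1 ht.2
  have h2 : ((n + 1 : ℕ) : ℕ∞) ≤ n := h1.trans h
  have : n + 1 ≤ n := by exact_mod_cast h2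
  omega

theorem holds_of_firstTime_eq {p : ℕ → Prop} {n : ℕ} (h : firstTime p = n) : p n := by
  obtain ⟨t, htn, h1, ht⟩ := firstTime_le_iff.1 h.le
  have h2 : (n : ℕ∞) ≤ t := h ▸ firstTime_le h1 ht
  have : n ≤ t := by exact_mod_cast h2
  rwa [le_antisymm this htn]

/-! ### The Leap rule at a fixed vector of log-likelihood ratios. -/

namespace StreamModel

section StopConditions

variable {K : ℕ} (o : EvidenceOrder K) (m₁ m₂ : ℕ) (a b : ℝ)

/-- The condition in the definition of `τ̂_i`. -/
def StopHat (i : ℕ) (x : Fin K → ℝ) : Prop :=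
  ENNReal.ofReal b ≤ orderStatSum x (o.posList x) 0 (m₁ - i) ∧
    ENNReal.ofReal a ≤ orderStatSum x (o.negList x) i m₂

/-- The condition in the definition of `τ̌_i`. -/
def StopCheck (i : ℕ) (x : Fin K → ℝ) : Prop :=
  ENNReal.ofReal b ≤ orderStatSum x (o.posList x) i m₁ ∧
    ENNReal.ofReal a ≤ orderStatSum x (o.negList x) 0 (m₂ - i)

/-- The Leap rule stops at the vector `x` of log-likelihood ratios. -/
def LeapStop (x : Fin K → ℝ) : Prop :=
  (∃ i ∈ Finset.range m₁, StopHat o m₁ m₂ a b i x) ∨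
    ∃ i ∈ Finset.Ico 1 m₂, StopCheck o m₁ m₂ a b i x

open Classical in
/-- The decision of the Leap rule when it stops at the vector `x` of log-likelihood ratios. -/
noncomputable def leapDecisionAt (x : Fin K → ℝ) : Finset (Fin K) :=
  ((Finset.range m₁).filter fun i => StopHat o m₁ m₂ a b i x).biUnion (fun i => decHat o i x) ∪
    ((Finset.Ico 1 m₂).filter fun i => StopCheck o m₁ m₂ a b i x).biUnion fun i => decCheck o i x

variable {o m₁ m₂ a b} {x : Fin K → ℝ}

theorem take_toFinset_mono (l : List (Fin K)) {i j : ℕ} (h : i ≤ j) :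
    (l.take i).toFinset ⊆ (l.take j).toFinset := fun k hk => by
  rw [List.mem_toFinset] at hk ⊢
  exact (List.take_prefix_take_left h).subset hk

/-- The candidate decisions are nested: `decHat` grows with `i`, `decCheck` shrinks with `i`, and
the set of positive streams separates the two families. Hence the union is a single candidate: the
largest active `decHat`, or else the smallest-index active `decCheck`. -/
theorem leapDecisionAt_eq (h : LeapStop o m₁ m₂ a b x) :
    (∃ i < m₁, StopHat o m₁ m₂ a b i x ∧ leapDecisionAt o m₁ m₂ a b x = decHat o i x) ∨
      ∃ i, i < m₂ ∧ StopCheck o m₁ m₂ a b i x ∧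
        leapDecisionAt o m₁ m₂ a b x = decCheck o i x := by
  classical
  set I := (Finset.range m₁).filter fun i => StopHat o m₁ m₂ a b i x with hI
  set J := (Finset.Ico 1 m₂).filter fun i => StopCheck o m₁ m₂ a b i x with hJ
  have hD : leapDecisionAt o m₁ m₂ a b x =
      I.biUnion (fun i => decHat o i x) ∪ J.biUnion fun i => decCheck o i x := by
    unfold leapDecisionAt
    congr
  rcases I.eq_empty_or_nonempty with he | hne
  · have hJne : J.Nonempty := by
      rcases h with ⟨i, hi, hs⟩ | ⟨i, hi, hs⟩
      · exact absurd (he ▸ Finset.mem_filter.2 ⟨hi, hs⟩ : i ∈ (∅ : Finset ℕ)) (Finset.notMem_empty i)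
      · exact ⟨i, Finset.mem_filter.2 ⟨hi, hs⟩⟩
    obtain ⟨i, hi, hmin⟩ := Finset.exists_min_image J id hJne
    have hi' := Finset.mem_filter.1 hi
    refine Or.inr ⟨i, (Finset.mem_Ico.1 hi'.1).2, hi'.2, ?_⟩
    rw [hD, he, Finset.biUnion_empty, Finset.empty_union]
    refine le_antisymm (Finset.biUnion_subset.2 fun j hj => ?_)
      (Finset.subset_biUnion_of_mem (fun i => decCheck o i x) hi)
    exact Finset.sdiff_subset_sdiff le_rfl (take_toFinset_mono _ (hmin j hj))
  · obtain ⟨i, hi, hmax⟩ := Finset.exists_max_image I id hne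
    have hi' := Finset.mem_filter.1 hi
    refine Or.inl ⟨i, Finset.mem_range.1 hi'.1, hi'.2, ?_⟩
    rw [hD]
    refine le_antisymm (Finset.union_subset (Finset.biUnion_subset.2 fun j hj => ?_)
      (Finset.biUnion_subset.2 fun j _ => ?_))
      ((Finset.subset_biUnion_of_mem (fun i => decHat o i x) hi).trans Finset.subset_union_left)
    · exact Finset.union_subset_union le_rfl (take_toFinset_mono _ (hmax j hj))
    · exact Finset.sdiff_subset.trans Finset.subset_union_left

theorem le_sum_of_ofReal_le {S : Finset (Fin K)} {c : ℝ} {y : Fin K → ℝ}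
    (hy : ∀ k ∈ S, |x k| = y k) (h : ENNReal.ofReal c ≤ ∑ k ∈ S, eabs x k) :
    c ≤ ∑ k ∈ S, y k := by
  unfold eabs at h
  rw [← ENNReal.ofReal_sum_of_nonneg fun k _ => abs_nonneg _, ENNReal.ofReal_le_ofReal_iff
    (Finset.sum_nonneg fun k _ => abs_nonneg _), Finset.sum_congr rfl hy] at h
  exact h

theorem abs_eq_of_subset_posList {S X : Finset (Fin K)} (h : S ⊆ (o.posList x).toFinset ∩ X) :
    ∀ k ∈ S, |x k| = x k := fun k hk => by
  have := (Finset.mem_inter.1 (h hk)).1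
  rw [List.mem_toFinset, o.mem_posList] at this
  exact abs_of_pos this

theorem abs_eq_of_subset_negList {S X : Finset (Fin K)} (h : S ⊆ (o.negList x).toFinset ∩ X) :
    ∀ k ∈ S, |x k| = -x k := fun k hk => by
  have := (Finset.mem_inter.1 (h hk)).1
  rw [List.mem_toFinset, o.mem_negList] at this
  exact abs_of_nonpos this

/-- The set `S` turns an error at `A` into strong evidence for the alternative `A ∪ S`. For false
negatives the alternative is `A \ S`. -/
theorem exists_subset_of_falsePositives (h : LeapStop o m₁ m₂ a b x) {A : Finset (Fin K)}
    (hm₁ : 0 < m₁) (herr : m₁ ≤ (leapDecisionAt o m₁ m₂ a b x \ A).card) :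
    ∃ S ⊆ Aᶜ, S.Nonempty ∧ S.card ≤ m₁ ∧ b ≤ ∑ k ∈ S, x k := by
  rcases leapDecisionAt_eq h with ⟨i, hi, hs, hD⟩ | ⟨i, hi, hs, hD⟩
  · rw [hD, decHat, o.filter_pos_eq, Finset.sdiff_eq_inter_compl] at herr
    obtain ⟨S, hS, hne, hc, hle⟩ := exists_subset_of_le_card_union (o.nodup_posList x)
      (o.pairwise_posList x) hi herr
    exact ⟨S, hS.trans Finset.inter_subset_right, hne, hc,
      le_sum_of_ofReal_le (abs_eq_of_subset_posList hS) (hs.1.trans hle)⟩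
  · rw [hD, decCheck, o.filter_pos_eq, Finset.sdiff_eq_inter_compl _ A] at herr
    obtain ⟨S, hS, hne, hc, hle⟩ := exists_subset_of_le_card_sdiff (o.nodup_posList x)
      (o.pairwise_posList x) hm₁ herr
    exact ⟨S, hS.trans Finset.inter_subset_right, hne, hc,
      le_sum_of_ofReal_le (abs_eq_of_subset_posList hS) (hs.1.trans hle)⟩

theorem exists_subset_of_falseNegatives (h : LeapStop o m₁ m₂ a b x) {A : Finset (Fin K)}
    (hm₂ : 0 < m₂) (herr : m₂ ≤ (A \ leapDecisionAt o m₁ m₂ a b x).card) :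
    ∃ S ⊆ A, S.Nonempty ∧ S.card ≤ m₂ ∧ a ≤ ∑ k ∈ S, -x k := by
  rcases leapDecisionAt_eq h with ⟨i, hi, hs, hD⟩ | ⟨i, hi, hs, hD⟩
  · have he : A \ leapDecisionAt o m₁ m₂ a b x =
        ((o.negList x).toFinset \ ((o.negList x).take i).toFinset) ∩ A := by
      rw [hD, decHat, o.filter_pos_eq, o.negList_toFinset]
      ext k; simp; tauto
    rw [he] at herr
    obtain ⟨S, hS, hne, hc, hle⟩ := exists_subset_of_le_card_sdiff (o.nodup_negList x)
      (o.pairwise_negList x) hm₂ herr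
    exact ⟨S, hS.trans Finset.inter_subset_right, hne, hc,
      le_sum_of_ofReal_le (abs_eq_of_subset_negList hS) (hs.2.trans hle)⟩
  · have he : A \ leapDecisionAt o m₁ m₂ a b x =
        ((o.negList x).toFinset ∪ ((o.posList x).take i).toFinset) ∩ A := by
      rw [hD, decCheck, o.filter_pos_eq, o.negList_toFinset]
      ext k; simp; tauto
    rw [he] at herr
    obtain ⟨S, hS, hne, hc, hle⟩ := exists_subset_of_le_card_union (o.nodup_negList x)
      (o.pairwise_negList x) hi herr
    exact ⟨S, hS.trans Finset.inter_subset_right, hne, hc,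
      le_sum_of_ofReal_le (abs_eq_of_subset_negList hS) (hs.2.trans hle)⟩

theorem sum_diffSign_mul (A B : Finset (Fin K)) (x : Fin K → ℝ) :
    ∑ k, diffSign A B k * x k = ∑ k ∈ A, x k - ∑ k ∈ B, x k := by
  simp only [diffSign, sub_mul, ite_mul, one_mul, zero_mul, Finset.sum_sub_distrib]
  simp

/-- The parameter `B` at which the decision `D` makes too many errors. -/
def IsError (m₁ m₂ : ℕ) (D B : Finset (Fin K)) : Prop :=
  m₁ ≤ (D \ B).card ∨ m₂ ≤ (B \ D).card

/-- If all the parameters at which some decision is erroneous are unlikely compared with `A`, then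
the Leap rule stops. -/
theorem leapStop_of_forall_isError (hm₁ : 0 < m₁) (hm₂ : 0 < m₂) {c : ℝ} (hc : 0 < c) (ha : a ≤ c)
    (hb : b ≤ c) {A D : Finset (Fin K)}
    (h : ∀ B, IsError m₁ m₂ D B → c ≤ ∑ k, diffSign A B k * x k) : LeapStop o m₁ m₂ a b x := by
  set P := (o.posList x).toFinset with hP
  have hPmem : ∀ k, k ∈ P ↔ 0 < x k := fun k => by rw [hP, List.mem_toFinset, o.mem_posList]
  have hN : (o.negList x).toFinset = Pᶜ := o.negList_toFinset x
  -- `P` maximizes `B ↦ ∑ k ∈ B, x k`, so the true parameter `A` can be replaced by `P` in the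
  -- hypothesis.
  have hAP : ∑ k ∈ A, x k ≤ ∑ k ∈ P, x k := by
    rw [← Finset.sum_inter_add_sum_sdiff A P, ← Finset.sum_inter_add_sum_sdiff P A,
      Finset.inter_comm]
    have h1 : ∑ k ∈ A \ P, x k ≤ 0 := Finset.sum_nonpos fun k hk =>
      not_lt.1 fun h' => (Finset.mem_sdiff.1 hk).2 ((hPmem k).2 h')
    have h2 : 0 ≤ ∑ k ∈ P \ A, x k := Finset.sum_nonneg fun k hk =>
      ((hPmem k).1 (Finset.mem_sdiff.1 hk).1).le
    linarith
  have h' : ∀ B, IsError m₁ m₂ D B → c ≤ ∑ k ∈ P, x k - ∑ k ∈ B, x k := fun B hB => by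
    have := h B hB
    rw [sum_diffSign_mul] at this
    linarith
  -- Taking `B = P` would give `c ≤ 0`. So `D` differs from `P` by fewer than `m₁` additions and
  -- fewer than `m₂` removals, which keeps the index found below in its range.
  have hPD : ¬ IsError m₁ m₂ D P := fun hE => by
    have := h' P hE
    linarith
  simp only [IsError, not_or, not_le] at hPD
  -- Test parameter `B = P \ S`: relative to it, the false positives of `D` include `D \ P` and `S ∩
  -- D`.
  have hpos : ∀ S ⊆ P, m₁ ≤ (D \ P).card + (S ∩ D).card →
      ENNReal.ofReal c ≤ ∑ k ∈ S, eabs x k := by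
    intro S hS hcard
    have h1 : c ≤ ∑ k ∈ P, x k - ∑ k ∈ P \ S, x k := by
      refine h' _ (Or.inl (hcard.trans ?_))
      rw [← Finset.card_union_of_disjoint]
      · refine Finset.card_le_card fun k => ?_
        simp only [Finset.mem_union, Finset.mem_sdiff, Finset.mem_inter]
        tauto
      · refine Finset.disjoint_left.2 fun k hk hk' => ?_
        exact (Finset.mem_sdiff.1 hk).2 (hS (Finset.mem_inter.1 hk').1)
    have h2 := Finset.sum_sdiff (f := x) hS
    unfold eabs
    rw [← ENNReal.ofReal_sum_of_nonneg fun k _ => abs_nonneg _]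
    refine ENNReal.ofReal_le_ofReal ?_
    have h3 : ∑ k ∈ S, x k ≤ ∑ k ∈ S, |x k| := Finset.sum_le_sum fun k _ => le_abs_self _
    linarith
  -- Test parameter `B = P ∪ S`: relative to it, `D` misses `P \ D` and `S \ D`.
  have hneg : ∀ S ⊆ Pᶜ, m₂ ≤ (P \ D).card + (S \ D).card →
      ENNReal.ofReal c ≤ ∑ k ∈ S, eabs x k := by
    intro S hS hcard
    have hdisj : Disjoint P S := Finset.disjoint_left.2 fun k hk hk' =>
      (Finset.mem_compl.1 (hS hk')) hk
    have h1 : c ≤ ∑ k ∈ P, x k - ∑ k ∈ P ∪ S, x k := by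
      refine h' _ (Or.inr (hcard.trans ?_))
      rw [Finset.union_sdiff_distrib, Finset.card_union_of_disjoint]
      exact hdisj.mono Finset.sdiff_subset Finset.sdiff_subset
    rw [Finset.sum_union hdisj] at h1
    unfold eabs
    rw [← ENNReal.ofReal_sum_of_nonneg fun k _ => abs_nonneg _]
    refine ENNReal.ofReal_le_ofReal ?_
    have h3 : -∑ k ∈ S, x k ≤ ∑ k ∈ S, |x k| := by
      rw [← Finset.sum_neg_distrib]
      exact Finset.sum_le_sum fun k _ => neg_le_abs _
    linarith
  have ha' := ENNReal.ofReal_le_ofReal ha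
  have hb' := ENNReal.ofReal_le_ofReal hb
  rcases le_or_gt (P \ D).card (D \ P).card with hle | hlt
  · have := le_orderStatSum_of_forall_subset (o.nodup_posList x) (o.nodup_negList x)
      (o.pairwise_negList x) (by rw [hN]; exact disjoint_compl_right) hpos
      (by rw [hN]; exact hneg) hle hm₂
    rw [← hP] at this
    exact Or.inl ⟨_, Finset.mem_range.2 (by omega), hb'.trans this.1, ha'.trans this.2⟩
  -- More removals than additions: the same lemma with signs, `m₁` and `m₂` exchanged and `D`
  -- complemented. The strict inequality makes the index at least `1`, as `τ̌_i` requires.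
  · have e1 : Dᶜ \ Pᶜ = P \ D := by ext k; simp; tauto
    have e2 : Pᶜ \ Dᶜ = D \ P := by ext k; simp; tauto
    have := le_orderStatSum_of_forall_subset (D := Dᶜ) (m := m₂) (m' := m₁)
      (a := ENNReal.ofReal c) (b := ENNReal.ofReal c) (o.nodup_negList x) (o.nodup_posList x)
      (o.pairwise_posList x) (by rw [hN]; exact disjoint_compl_left)
      (by
        rw [hN, e1]
        intro S hS hcard
        rw [← Finset.sdiff_eq_inter_compl] at hcard
        exact hneg S hS hcard)
      (by
        rw [hN, e2]
        intro S hS hcard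
        refine hpos S hS ?_
        rwa [Finset.sdiff_eq_inter_compl S, compl_compl] at hcard)
      (by rw [hN, e1, e2]; exact hlt.le) hm₁
    rw [hN, e1, e2] at this
    exact Or.inr ⟨_, Finset.mem_Ico.2 (by omega), hb'.trans this.2, ha'.trans this.1⟩

end StopConditions

end StreamModel

/-! ### Measurability: the Leap rule is a sequential procedure. -/

/-- Freezes a discrete quantity at each of its countably many values. The ordered lists are such
quantities, and along a fixed list the ordered sums are plainly measurable. -/
theorem MeasurableSet.setOf_comp_countable {X ι : Type*} [MeasurableSpace X] [Countable ι]
    {F : X → ι} (hF : ∀ i, MeasurableSet {x | F x = i}) {p : ι → X → Prop}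
    (hp : ∀ i, MeasurableSet {x | p i x}) : MeasurableSet {x | p (F x) x} := by
  have : {x | p (F x) x} = ⋃ i, {x | F x = i} ∩ {x | p i x} := by
    ext x; simp
  rw [this]
  exact MeasurableSet.iUnion fun i => (hF i).inter (hp i)

namespace EvidenceOrder

variable {K : ℕ} (o : EvidenceOrder K)

theorem measurableSet_filter_pos_eq (Z : Finset (Fin K)) :
    MeasurableSet {x : Fin K → ℝ | (Finset.univ.filter fun k => 0 < x k) = Z} := by
  have : {x : Fin K → ℝ | (Finset.univ.filter fun k => 0 < x k) = Z} =
      ⋂ k, {x | 0 < x k ↔ k ∈ Z} := by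
    ext x; simp [Finset.ext_iff]
  rw [this]
  refine MeasurableSet.iInter fun k => ?_
  have hk : MeasurableSet {x : Fin K → ℝ | 0 < x k} :=
    measurableSet_lt measurable_const (measurable_pi_apply k)
  by_cases h : k ∈ Z
  · simpa [h] using hk
  · simp only [h, iff_false]; exact hk.compl

theorem measurableSet_posList_eq (l : List (Fin K)) :
    MeasurableSet {x : Fin K → ℝ | o.posList x = l} := by
  refine MeasurableSet.setOf_comp_countable o.measurableSet_perm_eq
    (p := fun σ x => (List.ofFn σ).filter (fun k => 0 < x k) = l) fun σ => ?_
  have : {x : Fin K → ℝ | (List.ofFn σ).filter (fun k => 0 < x k) = l} =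
      {x | (List.ofFn σ).filter
        (fun k => k ∈ (Finset.univ.filter fun k => 0 < x k)) = l} := by
    ext x; simp
  rw [this]
  exact MeasurableSet.setOf_comp_countable measurableSet_filter_pos_eq
    (p := fun Z _ => (List.ofFn σ).filter (fun k => k ∈ Z) = l) fun Z => MeasurableSet.const _

theorem measurableSet_negList_eq (l : List (Fin K)) :
    MeasurableSet {x : Fin K → ℝ | o.negList x = l} := by
  refine MeasurableSet.setOf_comp_countable o.measurableSet_perm_eq
    (p := fun σ x => (List.ofFn σ).filter (fun k => x k ≤ 0) = l) fun σ => ?_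
  have : {x : Fin K → ℝ | (List.ofFn σ).filter (fun k => x k ≤ 0) = l} =
      {x | (List.ofFn σ).filter
        (fun k => k ∉ (Finset.univ.filter fun k => 0 < x k)) = l} := by
    ext x; simp
  rw [this]
  exact MeasurableSet.setOf_comp_countable measurableSet_filter_pos_eq
    (p := fun Z _ => (List.ofFn σ).filter (fun k => k ∉ Z) = l) fun Z => MeasurableSet.const _

end EvidenceOrder

theorem measurable_orderStatSum {K : ℕ} (l : List (Fin K)) (i n : ℕ) :
    Measurable fun x => orderStatSum x l i n := by
  refine Finset.measurable_fun_sum _ fun j _ => ?_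
  unfold orderStat
  cases l[j - 1]? with
  | none => exact measurable_const
  | some k => exact (measurable_pi_apply k).abs.ennreal_ofReal

namespace StreamModel

section StopConditions

variable {K : ℕ} (o : EvidenceOrder K) (m₁ m₂ : ℕ) (a b : ℝ)

theorem measurableSet_stopHat (i : ℕ) : MeasurableSet {x | StopHat o m₁ m₂ a b i x} := by
  refine MeasurableSet.inter ?_ ?_
  · exact MeasurableSet.setOf_comp_countable o.measurableSet_posList_eq
      (p := fun l x => ENNReal.ofReal b ≤ orderStatSum x l 0 (m₁ - i)) fun l =>
      measurableSet_le measurable_const (measurable_orderStatSum l _ _)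
  · exact MeasurableSet.setOf_comp_countable o.measurableSet_negList_eq
      (p := fun l x => ENNReal.ofReal a ≤ orderStatSum x l i m₂) fun l =>
      measurableSet_le measurable_const (measurable_orderStatSum l _ _)

theorem measurableSet_stopCheck (i : ℕ) : MeasurableSet {x | StopCheck o m₁ m₂ a b i x} := by
  refine MeasurableSet.inter ?_ ?_
  · exact MeasurableSet.setOf_comp_countable o.measurableSet_posList_eq
      (p := fun l x => ENNReal.ofReal b ≤ orderStatSum x l i m₁) fun l =>
      measurableSet_le measurable_const (measurable_orderStatSum l _ _)
  · exact MeasurableSet.setOf_comp_countable o.measurableSet_negList_eq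
      (p := fun l x => ENNReal.ofReal a ≤ orderStatSum x l 0 (m₂ - i)) fun l =>
      measurableSet_le measurable_const (measurable_orderStatSum l _ _)

theorem measurableSet_leapStop : MeasurableSet {x | LeapStop o m₁ m₂ a b x} := by
  have : {x | LeapStop o m₁ m₂ a b x} =
      (⋃ i ∈ Finset.range m₁, {x | StopHat o m₁ m₂ a b i x}) ∪
        ⋃ i ∈ Finset.Ico 1 m₂, {x | StopCheck o m₁ m₂ a b i x} := by
    ext x; simp [LeapStop]
  rw [this]
  exact (MeasurableSet.iUnion fun i => MeasurableSet.iUnion fun _ =>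
    measurableSet_stopHat o m₁ m₂ a b i).union (MeasurableSet.iUnion fun i =>
    MeasurableSet.iUnion fun _ => measurableSet_stopCheck o m₁ m₂ a b i)

theorem measurableSet_mem_decHat (i : ℕ) (k : Fin K) :
    MeasurableSet {x | k ∈ decHat o i x} := by
  have : {x | k ∈ decHat o i x} =
      {x : Fin K → ℝ | 0 < x k} ∪ {x | k ∈ ((o.negList x).take i).toFinset} := by
    ext x; simp [decHat]
  rw [this]
  exact (measurableSet_lt measurable_const (measurable_pi_apply k)).union
    (MeasurableSet.setOf_comp_countable o.measurableSet_negList_eq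
      (p := fun l _ => k ∈ (l.take i).toFinset) fun l => MeasurableSet.const _)

theorem measurableSet_mem_decCheck (i : ℕ) (k : Fin K) :
    MeasurableSet {x | k ∈ decCheck o i x} := by
  have : {x | k ∈ decCheck o i x} =
      {x : Fin K → ℝ | 0 < x k} ∩ {x | k ∈ ((o.posList x).take i).toFinset}ᶜ := by
    ext x; simp [decCheck]
  rw [this]
  exact (measurableSet_lt measurable_const (measurable_pi_apply k)).inter
    (MeasurableSet.setOf_comp_countable o.measurableSet_posList_eq
      (p := fun l _ => k ∈ (l.take i).toFinset) fun l => MeasurableSet.const _).compl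

theorem measurableSet_leapDecisionAt_eq (d : Finset (Fin K)) :
    MeasurableSet {x | leapDecisionAt o m₁ m₂ a b x = d} := by
  have hk : ∀ k, MeasurableSet {x | k ∈ leapDecisionAt o m₁ m₂ a b x} := fun k => by
    have : {x | k ∈ leapDecisionAt o m₁ m₂ a b x} =
        (⋃ i ∈ Finset.range m₁, {x | StopHat o m₁ m₂ a b i x} ∩ {x | k ∈ decHat o i x}) ∪
          ⋃ i ∈ Finset.Ico 1 m₂,
            {x | StopCheck o m₁ m₂ a b i x} ∩ {x | k ∈ decCheck o i x} := by
      ext x; simp [leapDecisionAt, and_assoc, and_left_comm]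
    rw [this]
    exact (MeasurableSet.iUnion fun i => MeasurableSet.iUnion fun _ =>
      (measurableSet_stopHat o m₁ m₂ a b i).inter (measurableSet_mem_decHat o i k)).union
      (MeasurableSet.iUnion fun i => MeasurableSet.iUnion fun _ =>
        (measurableSet_stopCheck o m₁ m₂ a b i).inter (measurableSet_mem_decCheck o i k))
  have : {x | leapDecisionAt o m₁ m₂ a b x = d} =
      ⋂ k, {x | k ∈ leapDecisionAt o m₁ m₂ a b x ↔ k ∈ d} := by
    ext x; simp [Finset.ext_iff]
  rw [this]
  refine MeasurableSet.iInter fun k => ?_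
  by_cases h : k ∈ d
  · simpa [h] using hk k
  · simp only [h, iff_false]; exact (hk k).compl

end StopConditions

variable {K : ℕ} {𝒳 : Fin K → Type*} [∀ k, MeasurableSpace (𝒳 k)] (M : StreamModel K 𝒳)
  (o : EvidenceOrder K) (m₁ m₂ : ℕ) (a b : ℝ)

/-- A minimum of first passage times is the first passage time of the disjunction, so the rule is
governed by one condition on the current vector. -/
theorem leapTime_eq_firstTime (ω : SamplePath K 𝒳) :
    M.leapTime o m₁ m₂ a b ω = firstTime fun t => LeapStop o m₁ m₂ a b (M.llr ω t) := by
  refine le_antisymm (le_iInf₂ fun t ht => ?_) (le_inf ?_ ?_)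
  · rcases ht.2 with ⟨i, hi, hs⟩ | ⟨i, hi, hs⟩
    · exact (inf_le_left.trans (iInf₂_le i hi)).trans (firstTime_le ht.1 hs)
    · exact (inf_le_right.trans (iInf₂_le i hi)).trans (firstTime_le ht.1 hs)
  · exact le_iInf₂ fun i hi => firstTime_anti fun t ht => Or.inl ⟨i, hi, ht⟩
  · exact le_iInf₂ fun i hi => firstTime_anti fun t ht => Or.inr ⟨i, hi, ht⟩

theorem one_le_leapTime (ω : SamplePath K 𝒳) : 1 ≤ M.leapTime o m₁ m₂ a b ω := by
  rw [leapTime_eq_firstTime]; exact one_le_firstTime _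

variable {M o m₁ m₂ a b}

theorem leapStop_of_leapTime_eq {ω : SamplePath K 𝒳} {n : ℕ}
    (h : M.leapTime o m₁ m₂ a b ω = n) : LeapStop o m₁ m₂ a b (M.llr ω n) := by
  rw [leapTime_eq_firstTime] at h
  exact holds_of_firstTime_eq h

theorem leapDecision_eq {ω : SamplePath K 𝒳} {n : ℕ} (h : M.leapTime o m₁ m₂ a b ω = n) :
    M.leapDecision o m₁ m₂ a b ω = leapDecisionAt o m₁ m₂ a b (M.llr ω n) := by
  have hn : 1 ≤ n := by
    have := M.one_le_leapTime o m₁ m₂ a b ω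
    rw [h] at this
    exact_mod_cast this
  -- None of the competing times can precede `n`, so one of them equals `n` exactly when its
  -- condition holds at `n`.
  have key : ∀ p : ℕ → Prop, M.leapTime o m₁ m₂ a b ω ≤ firstTime p →
      (firstTime p = n ↔ p n) := fun p hp =>
    ⟨holds_of_firstTime_eq, fun hpn => le_antisymm (firstTime_le hn hpn) (h ▸ hp)⟩
  have h1 : ∀ i ∈ Finset.range m₁, (M.tauHat o m₁ m₂ a b i ω = n ↔
      StopHat o m₁ m₂ a b i (M.llr ω n)) := fun i hi =>
    key _ (inf_le_left.trans (iInf₂_le i hi))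
  have h2 : ∀ i ∈ Finset.Ico 1 m₂, (M.tauCheck o m₁ m₂ a b i ω = n ↔
      StopCheck o m₁ m₂ a b i (M.llr ω n)) := fun i hi =>
    key _ (inf_le_right.trans (iInf₂_le i hi))
  classical
  unfold leapDecision leapDecisionAt
  simp only [h, ENat.natCast_ne_top, if_false, ENat.toNat_natCast]
  congr 2
  · exact Finset.filter_congr h1
  · exact Finset.filter_congr h2

variable (M o m₁ m₂ a b)

theorem isStoppingTime_leapTime :
    IsStoppingTime (obsFiltration K 𝒳) (M.leapTime o m₁ m₂ a b) := by
  intro n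
  have : {ω | M.leapTime o m₁ m₂ a b ω ≤ (n : ℕ)} = ⋃ t, ⋃ (_ : t ≤ n), ⋃ (_ : 1 ≤ t),
      (fun ω => M.llr ω t) ⁻¹' {x | LeapStop o m₁ m₂ a b x} := by
    ext ω
    simp [leapTime_eq_firstTime, firstTime_le_iff, and_left_comm]
  change MeasurableSet[obsFiltration K 𝒳 n] {ω | M.leapTime o m₁ m₂ a b ω ≤ (n : ℕ∞)}
  rw [this]
  exact MeasurableSet.iUnion fun t => MeasurableSet.iUnion fun ht => MeasurableSet.iUnion fun _ =>
    (obsFiltration K 𝒳).mono ht _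
      (M.measurable_llr_obsFiltration t (measurableSet_leapStop o m₁ m₂ a b))

theorem isSequentialProcedure_leapRule :
    IsSequentialProcedure (M.leapRule o m₁ m₂ a b) := by
  refine ⟨M.one_le_leapTime o m₁ m₂ a b, M.isStoppingTime_leapTime o m₁ m₂ a b, fun d => ?_⟩
  have hT := M.isStoppingTime_leapTime o m₁ m₂ a b
  -- On `{T = t}` the decision is a function of the log-likelihood ratios at time `t`.
  have hpiece : ∀ t : ℕ, MeasurableSet[obsFiltration K 𝒳 t]
      ({ω | M.leapTime o m₁ m₂ a b ω = t} ∩ {ω | M.leapDecision o m₁ m₂ a b ω = d}) := fun t => by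
    have : {ω | M.leapTime o m₁ m₂ a b ω = t} ∩ {ω | M.leapDecision o m₁ m₂ a b ω = d} =
        {ω | M.leapTime o m₁ m₂ a b ω = t} ∩
          (fun ω => M.llr ω t) ⁻¹' {x | leapDecisionAt o m₁ m₂ a b x = d} := by
      ext ω
      refine and_congr_right fun h => ?_
      simp only [Set.mem_ofPred_eq, Set.mem_preimage, leapDecision_eq h]
    rw [this]
    exact (hT.measurableSet_eq t).inter
      (M.measurable_llr_obsFiltration t (measurableSet_leapDecisionAt_eq o m₁ m₂ a b d))
  have hle : ∀ t, (obsFiltration K 𝒳 t : MeasurableSpace (SamplePath K 𝒳)) ≤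
      ⨆ t, obsFiltration K 𝒳 t := fun t => le_iSup (fun t => obsFiltration K 𝒳 t) t
  refine (IsStoppingTime.measurableSet hT _).2 ⟨?_, fun n => ?_⟩
  · have htop : {ω | M.leapTime o m₁ m₂ a b ω = ⊤} =
        (⋃ t : ℕ, {ω | M.leapTime o m₁ m₂ a b ω = t})ᶜ := by
      ext ω
      simp only [Set.mem_ofPred_eq, Set.mem_compl_iff, Set.mem_iUnion, ENat.eq_top_iff_forall_ne,
        not_exists, ne_comm]
    have : {ω | (M.leapRule o m₁ m₂ a b).D ω = d} =
        (⋃ t : ℕ, {ω | M.leapTime o m₁ m₂ a b ω = t} ∩ {ω | M.leapDecision o m₁ m₂ a b ω = d}) ∪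
          ({ω | M.leapTime o m₁ m₂ a b ω = ⊤} ∩ {_ω | ∅ = d}) := by
      ext ω
      simp only [leapRule, Set.mem_ofPred_eq, Set.mem_union, Set.mem_iUnion, Set.mem_inter_iff]
      by_cases h : M.leapTime o m₁ m₂ a b ω = ⊤
      · simp [leapDecision, h]
      · obtain ⟨n, hn⟩ := ENat.ne_top_iff_exists.1 h
        simp [← hn]
    rw [this]
    refine MeasurableSet.union (MeasurableSet.iUnion fun t => hle t _ (hpiece t))
      (MeasurableSet.inter ?_ (MeasurableSet.const _))
    rw [htop]
    exact (MeasurableSet.iUnion fun t => hle t _ (hT.measurableSet_eq t)).compl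
  · have : {ω | (M.leapRule o m₁ m₂ a b).D ω = d} ∩
        {ω | (M.leapRule o m₁ m₂ a b).T ω ≤ (n : ℕ∞)} =
        ⋃ t, ⋃ (_ : t ≤ n), {ω | M.leapTime o m₁ m₂ a b ω = t} ∩
          {ω | M.leapDecision o m₁ m₂ a b ω = d} := by
      ext ω
      simp only [leapRule, Set.mem_ofPred_eq, Set.mem_iUnion, Set.mem_inter_iff, exists_prop]
      constructor
      · rintro ⟨hd, hle⟩
        obtain ⟨t, ht⟩ := ENat.ne_top_iff_exists.1 (ne_top_of_le_ne_top (ENat.natCast_ne_top n) hle)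
        rw [← ht] at hle
        exact ⟨t, by exact_mod_cast hle, ht.symm, hd⟩
      · rintro ⟨t, htn, ht, hd⟩
        exact ⟨hd, ht ▸ by exact_mod_cast htn⟩
    change MeasurableSet[obsFiltration K 𝒳 n] ({ω | (M.leapRule o m₁ m₂ a b).D ω = d} ∩
        {ω | (M.leapRule o m₁ m₂ a b).T ω ≤ (n : ℕ∞)})
    rw [this]
    exact MeasurableSet.iUnion fun t => MeasurableSet.iUnion fun ht =>
      (obsFiltration K 𝒳).mono ht _ (hpiece t)

end StreamModel

/-! ### Remaining time, finiteness and error control. -/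

/-- Turns the expected time after `n` into a sum of tail probabilities. Equality fails when `τ < n`,
as happens if the Leap rule stops before its competitor. -/
theorem ENat.toENNReal_le_add_tsum (τ : ℕ∞) (n : ℕ) :
    (τ : ℝ≥0∞) ≤ n + ∑' j : ℕ, if ((n + j : ℕ) : ℕ∞) < τ then (1 : ℝ≥0∞) else 0 := by
  induction τ using ENat.recTopCoe with
  | top => simp
  | coe m =>
    have h1 : ∑ j ∈ Finset.range (m - n), (if ((n + j : ℕ) : ℕ∞) < (m : ℕ∞) then (1 : ℝ≥0∞) else 0)
        = ((m - n : ℕ) : ℝ≥0∞) := by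
      rw [Finset.sum_congr rfl (g := fun _ => (1 : ℝ≥0∞)), Finset.sum_const, Finset.card_range,
        nsmul_one]
      intro j hj
      have : n + j < m := by have := Finset.mem_range.1 hj; omega
      rw [if_pos (by exact_mod_cast this)]
    have h2 : ((m - n : ℕ) : ℝ≥0∞) ≤
        ∑' j : ℕ, if ((n + j : ℕ) : ℕ∞) < (m : ℕ∞) then (1 : ℝ≥0∞) else 0 :=
      h1 ▸ ENNReal.sum_le_tsum _
    refine le_trans ?_ (add_le_add le_rfl h2)
    rw [ENat.toENNReal_coe]
    exact_mod_cast (by omega : m ≤ n + (m - n))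

/-- There are at most `2 ^ m * (K choose m)` sets of size at most `m`. -/
theorem card_filter_card_le (K m : ℕ) (hm : m ≤ K) (p : Finset (Fin K) → Prop) [DecidablePred p]
    (hp : ∀ S, p S → S.card ≤ m) : (Finset.univ.filter p).card ≤ 2 ^ m * K.choose m := by
  have hsub : Finset.univ.filter p ⊆
      (Finset.powersetCard m (Finset.univ : Finset (Fin K))).biUnion Finset.powerset := by
    intro S hS
    obtain ⟨T, hST, hT⟩ := Finset.exists_superset_card_eq (hp S (Finset.mem_filter.1 hS).2)
      (by simpa using hm)
    exact Finset.mem_biUnion.2 ⟨T, Finset.mem_powersetCard.2 ⟨Finset.subset_univ _, hT⟩,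
      Finset.mem_powerset.2 hST⟩
  refine (Finset.card_le_card hsub).trans (Finset.card_biUnion_le.trans ?_)
  rw [Finset.sum_congr rfl fun T hT => by
    rw [Finset.card_powerset, (Finset.mem_powersetCard.1 hT).2], Finset.sum_const,
    Finset.card_powersetCard, Finset.card_univ, Fintype.card_fin, smul_eq_mul, mul_comm]

section Threshold

variable {K m : ℕ} {γ : ℝ}

theorem threshold_factor_pos (hm : m ≤ K) : (0 : ℝ) < 2 ^ m * (K.choose m : ℝ) := by
  have : 0 < K.choose m := Nat.choose_pos hm
  positivity

theorem exp_leapThreshold (hm : m ≤ K) (h0 : 0 < γ) (h1 : γ < 1) :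
    Real.exp (leapThreshold K m γ) = 2 ^ m * (K.choose m : ℝ) / γ := by
  rw [leapThreshold, abs_of_neg (Real.log_neg h0 h1), Real.exp_add, Real.exp_neg, Real.exp_log h0,
    Real.exp_log (threshold_factor_pos hm)]
  field_simp

theorem leapThreshold_pos (hm : m ≤ K) (h0 : 0 < γ) (h1 : γ < 1) : 0 < leapThreshold K m γ := by
  have h2 : (1 : ℝ) ≤ 2 ^ m * (K.choose m : ℝ) := by
    have : 1 ≤ 2 ^ m * K.choose m := Nat.mul_pos (by positivity) (Nat.choose_pos hm)
    exact_mod_cast this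
  have h3 := Real.log_nonneg h2
  have h4 : 0 < |Real.log γ| := abs_pos.2 (Real.log_neg h0 h1).ne
  unfold leapThreshold; linarith

end Threshold

namespace StreamModel

variable {K : ℕ} {𝒳 : Fin K → Type*} [∀ k, MeasurableSpace (𝒳 k)] {M : StreamModel K 𝒳}

/-- The union bound over a family of alternatives. -/
theorem measure_exists_alternative_le (hM : M.LLRMomentAssumption) {m : ℕ} (hm : m ≤ K) {γ : ℝ}
    (h0 : 0 < γ) (h1 : γ < 1) (A : Finset (Fin K)) (p : Finset (Fin K) → Prop)
    (hp : ∀ S, p S → S.card ≤ m) (G : Finset (Fin K) → Finset (Fin K)) :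
    M.P A {ω | ∃ S, p S ∧ ∃ n, leapThreshold K m γ ≤ -M.jointLLR A (G S) n ω} ≤
      ENNReal.ofReal γ := by
  classical
  have hsub : {ω | ∃ S, p S ∧ ∃ n, leapThreshold K m γ ≤ -M.jointLLR A (G S) n ω} ⊆
      ⋃ S ∈ Finset.univ.filter p, {ω | ∃ n, leapThreshold K m γ ≤ -M.jointLLR A (G S) n ω} := by
    rintro ω ⟨S, hS, hn⟩
    exact Set.mem_iUnion₂.2 ⟨S, Finset.mem_filter.2 ⟨Finset.mem_univ _, hS⟩, hn⟩
  refine (measure_mono hsub).trans ((measure_biUnion_finset_le _ _).trans ?_)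
  -- Each alternative contributes at most `γ / (2 ^ m * K.choose m)`, and there are at most `2 ^ m *
  -- K.choose m` sets `S`.
  refine (Finset.sum_le_card_nsmul _ _ _ fun S _ =>
    measure_exists_le_neg_jointLLR hM A (G S) _).trans ?_
  rw [nsmul_eq_mul, ← ENNReal.ofReal_natCast, ← ENNReal.ofReal_mul (by positivity)]
  refine ENNReal.ofReal_le_ofReal ?_
  have hN := threshold_factor_pos (K := K) (m := m) hm
  have hcard : ((Finset.univ.filter p).card : ℝ) ≤ 2 ^ m * (K.choose m : ℝ) := by
    exact_mod_cast card_filter_card_le K m hm p hp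
  rw [Real.exp_neg, exp_leapThreshold hm h0 h1, inv_div, mul_div_assoc', div_le_iff₀ hN, mul_comm]
  exact mul_le_mul_of_nonneg_left hcard h0.le

section Leap

variable (o : EvidenceOrder K) {m₁ m₂ : ℕ}

theorem measurableSet_lt_leapTime (a b : ℝ) (n : ℕ) : MeasurableSet[obsFiltration K 𝒳 n]
    {ω | (n : ℕ∞) < M.leapTime o m₁ m₂ a b ω} := by
  have h : MeasurableSet[obsFiltration K 𝒳 n] {ω | M.leapTime o m₁ m₂ a b ω ≤ (n : ℕ∞)} :=
    M.isStoppingTime_leapTime o m₁ m₂ a b n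
  have : {ω | (n : ℕ∞) < M.leapTime o m₁ m₂ a b ω} =
      {ω | M.leapTime o m₁ m₂ a b ω ≤ (n : ℕ∞)}ᶜ := by
    ext ω; simp
  rw [this]
  exact h.compl

open Classical in
/-- The expected remaining time of the Leap rule after time `n`. The bound is in terms of the
likelihood ratios at the parameters for which `D` is erroneous. -/
theorem exists_remainingTime_bound (hM : M.LLRMomentAssumption) (A : Finset (Fin K)) :
    ∃ L c : ℝ, 0 < L ∧ 0 < c ∧ ∀ (m₁ m₂ : ℕ), 0 < m₁ → 0 < m₂ → ∀ (a b : ℝ), 0 < max a b →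
      ∀ (D : Finset (Fin K)), ¬ IsError m₁ m₂ D A → ∀ n, 1 ≤ n → ∀ (E : Set (SamplePath K 𝒳)),
      MeasurableSet[obsFiltration K 𝒳 n] E →
      (ENNReal.ofReal c * ∑' j : ℕ,
          M.P A (E ∩ {ω | ((n + j : ℕ) : ℕ∞) < M.leapTime o m₁ m₂ a b ω}) ≤
        ∑ B, ((if IsError m₁ m₂ D B then ENNReal.ofReal (Real.exp (max a b)) * M.P B E else 0) +
          ENNReal.ofReal L * M.P A E)) ∧
      ENNReal.ofReal c * ∑' j : ℕ,
          M.P A (E ∩ {ω | ((n + j : ℕ) : ℕ∞) < M.leapTime o m₁ m₂ a b ω}) ≤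
        ∑ B, (M.P B E + ENNReal.ofReal (max a b + L) * M.P A E) := by
  obtain ⟨L, c, hL, hc, H⟩ := exists_excursion_bound hM A
  refine ⟨L, c, hL, hc, fun m₁ m₂ hm₁ hm₂ a b hab D hDA n hn E hE => ?_⟩
  set F : ℕ → Set (SamplePath K 𝒳) := fun j =>
    E ∩ {ω | ((n + j : ℕ) : ℕ∞) < M.leapTime o m₁ m₂ a b ω} with hF
  have hFm : ∀ j, MeasurableSet[obsFiltration K 𝒳 (n + j)] (F j) := fun j =>
    MeasurableSet.inter ((obsFiltration K 𝒳).mono (Nat.le_add_right n j) _ hE)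
      (measurableSet_lt_leapTime o a b (n + j))
  have hFanti : Antitone F := fun i j hij ω hω => by
    have hle : ((n + i : ℕ) : ℕ∞) ≤ ((n + j : ℕ) : ℕ∞) := by
      exact_mod_cast Nat.add_le_add_left hij n
    exact ⟨hω.1, hle.trans_lt (show _ < M.leapTime o m₁ m₂ a b ω from hω.2)⟩
  have hF0 : MeasurableSet[obsFiltration K 𝒳 n] (F 0) := hFm 0
  have hF0E : F 0 ⊆ E := Set.inter_subset_left
  -- Contrapositive of `leapStop_of_forall_isError`: before stopping, some relevant walk is below
  -- `max a b`. The rule cannot stop at time `0`, hence the requirement `1 ≤ n`.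
  have hFlow : ∀ j, ∀ ω ∈ F j, ∃ B ∈ Finset.univ.filter (IsError m₁ m₂ D),
      M.jointLLR A B (n + j) ω < max a b := by
    intro j ω hω
    by_contra! hcon
    refine absurd (show _ < M.leapTime o m₁ m₂ a b ω from hω.2) (not_lt.2 ?_)
    rw [leapTime_eq_firstTime]
    refine firstTime_le (by omega) (leapStop_of_forall_isError hm₁ hm₂ hab (le_max_left _ _)
      (le_max_right _ _) (A := A) (D := D) fun B hB => ?_)
    rw [← jointLLR_eq]
    exact hcon B (Finset.mem_filter.2 ⟨Finset.mem_univ _, hB⟩)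
  have hbase := H (Finset.univ.filter (IsError m₁ m₂ D))
    (fun h => hDA (Finset.mem_filter.1 h).2) (max a b) n F hFm hFanti hFlow
  constructor
  · refine hbase.trans ?_
    rw [Finset.sum_filter]
    refine Finset.sum_le_sum fun B _ => ?_
    split_ifs
    · refine (setLIntegral_deficit_le_exp hM A B hL.le hF0).trans ?_
      gcongr
    · exact zero_le
  · refine hbase.trans ?_
    refine (Finset.sum_le_sum_of_subset (Finset.filter_subset _ _)).trans
      (Finset.sum_le_sum fun B _ => ?_)
    refine (setLIntegral_deficit_le_add hM A B hL.le hab.le hF0).trans ?_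
    gcongr

theorem not_isError_self {m₁ m₂ : ℕ} (hm₁ : 0 < m₁) (hm₂ : 0 < m₂) (A : Finset (Fin K)) :
    ¬ IsError m₁ m₂ A A := by
  simp [IsError]; omega

theorem lintegral_tsum_ite_lt_leapTime (A : Finset (Fin K)) (a b : ℝ) (n : ℕ)
    (E : Set (SamplePath K 𝒳)) :
    ∫⁻ ω in E, ∑' j : ℕ, (if ((n + j : ℕ) : ℕ∞) < M.leapTime o m₁ m₂ a b ω then (1 : ℝ≥0∞) else 0)
        ∂(M.P A) =
      ∑' j : ℕ, M.P A (E ∩ {ω | ((n + j : ℕ) : ℕ∞) < M.leapTime o m₁ m₂ a b ω}) := by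
  have hm : ∀ j : ℕ, MeasurableSet {ω | ((n + j : ℕ) : ℕ∞) < M.leapTime o m₁ m₂ a b ω} :=
    fun j => (obsFiltration K 𝒳).le _ _ (measurableSet_lt_leapTime o a b (n + j))
  rw [lintegral_tsum fun j =>
    (Measurable.ite (hm j) measurable_const measurable_const).aemeasurable]
  refine tsum_congr fun j => ?_
  have : (fun ω => if ((n + j : ℕ) : ℕ∞) < M.leapTime o m₁ m₂ a b ω then (1 : ℝ≥0∞) else 0) =
      {ω | ((n + j : ℕ) : ℕ∞) < M.leapTime o m₁ m₂ a b ω}.indicator 1 := by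
    ext ω; simp [Set.indicator_apply]
  rw [this, lintegral_indicator_one (hm j), Measure.restrict_apply (hm j), Set.inter_comm]

/-- The second remaining-time bound from time `1` on the whole space, with the true set `A` as
reference decision. -/
theorem ESS_leapRule_lt_top (hM : M.LLRMomentAssumption) (hm₁ : 0 < m₁) (hm₂ : 0 < m₂)
    (A : Finset (Fin K)) {a b : ℝ} (hab : 0 < max a b) :
    M.ESS A (M.leapRule o m₁ m₂ a b) < ⊤ := by
  obtain ⟨L, c, hL, hc, H⟩ := exists_remainingTime_bound o hM A
  have h := (H m₁ m₂ hm₁ hm₂ a b hab A (not_isError_self hm₁ hm₂ A) 1 le_rfl Set.univ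
    MeasurableSet.univ).2
  have hfin : ∑' j : ℕ, M.P A (Set.univ ∩
      {ω | ((1 + j : ℕ) : ℕ∞) < M.leapTime o m₁ m₂ a b ω}) < ⊤ := by
    refine ENNReal.lt_top_of_mul_ne_top_right (ne_top_of_le_ne_top ?_ h)
      (ENNReal.ofReal_pos.2 hc).ne'
    simp [ENNReal.mul_eq_top]
  calc M.ESS A (M.leapRule o m₁ m₂ a b)
      ≤ ∫⁻ ω, ((1 : ℕ) + ∑' j : ℕ,
        (if ((1 + j : ℕ) : ℕ∞) < M.leapTime o m₁ m₂ a b ω then (1 : ℝ≥0∞) else 0)) ∂(M.P A) :=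
        lintegral_mono fun ω => ENat.toENNReal_le_add_tsum _ 1
    _ = 1 + ∑' j : ℕ, M.P A (Set.univ ∩
        {ω | ((1 + j : ℕ) : ℕ∞) < M.leapTime o m₁ m₂ a b ω}) := by
        rw [lintegral_add_left measurable_const, ← lintegral_tsum_ite_lt_leapTime o A a b 1
          Set.univ, Measure.restrict_univ]
        simp
    _ < ⊤ := ENNReal.add_lt_top.2 ⟨ENNReal.one_lt_top, hfin⟩

theorem measurable_leapTime (a b : ℝ) : Measurable (M.leapTime o m₁ m₂ a b) := by
  have hT : ∀ n : ℕ, MeasurableSet {ω | M.leapTime o m₁ m₂ a b ω = n} := fun n =>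
    (obsFiltration K 𝒳).le n _ ((M.isStoppingTime_leapTime o m₁ m₂ a b).measurableSet_eq n)
  refine measurable_to_countable' fun τ => ?_
  induction τ using ENat.recTopCoe with
  | coe n => exact hT n
  | top =>
    have : M.leapTime o m₁ m₂ a b ⁻¹' {⊤} =
        (⋃ n : ℕ, {ω | M.leapTime o m₁ m₂ a b ω = n})ᶜ := by
      ext ω
      simp only [Set.mem_preimage, Set.mem_singleton_iff, Set.mem_compl_iff, Set.mem_iUnion,
        Set.mem_ofPred_eq, ENat.eq_top_iff_forall_ne, not_exists, ne_comm]
    rw [this]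
    exact (MeasurableSet.iUnion hT).compl

theorem measure_leapTime_eq_top {a b : ℝ} {A : Finset (Fin K)}
    (h : M.ESS A (M.leapRule o m₁ m₂ a b) < ⊤) :
    M.P A {ω | M.leapTime o m₁ m₂ a b ω = ⊤} = 0 := by
  have hm : Measurable fun ω => (M.leapTime o m₁ m₂ a b ω : ℝ≥0∞) :=
    (Measurable.of_discrete (f := fun τ : ℕ∞ => (τ : ℝ≥0∞))).comp (measurable_leapTime o a b)
  have := ae_lt_top hm h.ne
  rw [ae_iff] at this
  convert this using 3 with ω
  simp

/-- Up to the null event that the rule never stops, an error at `A` forces the likelihood ratio of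
some `A ∪ S` or `A \ S` against `A` to reach the exponential of the threshold; the union bound over
`S` finishes. -/
theorem leapRule_mem_gfrClass (hM : M.LLRMomentAssumption) (hm₁ : 0 < m₁) (hm₂ : 0 < m₂)
    (hm : m₁ + m₂ ≤ K) {α β : ℝ} (hα : α ∈ Set.Ioo (0 : ℝ) 1) (hβ : β ∈ Set.Ioo (0 : ℝ) 1) :
    M.leapRule o m₁ m₂ (leapThreshold K m₂ β) (leapThreshold K m₁ α) ∈
      M.gfrClass m₁ m₂ α β := by
  set a := leapThreshold K m₂ β with ha
  set b := leapThreshold K m₁ α with hb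
  have hab : 0 < max a b :=
    lt_max_of_lt_left (leapThreshold_pos (by omega) hβ.1 hβ.2)
  have htop : ∀ A, M.P A {ω | M.leapTime o m₁ m₂ a b ω = ⊤} = 0 := fun A =>
    measure_leapTime_eq_top o (ESS_leapRule_lt_top o hM hm₁ hm₂ A hab)
  have hcase : ∀ ω, M.leapTime o m₁ m₂ a b ω = ⊤ ∨ ∃ n : ℕ,
      LeapStop o m₁ m₂ a b (M.llr ω n) ∧
      (M.leapRule o m₁ m₂ a b).D ω = leapDecisionAt o m₁ m₂ a b (M.llr ω n) := fun ω => by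
    by_cases h : M.leapTime o m₁ m₂ a b ω = ⊤
    · exact Or.inl h
    · obtain ⟨n, hn⟩ := ENat.ne_top_iff_exists.1 h
      exact Or.inr ⟨n, leapStop_of_leapTime_eq hn.symm, leapDecision_eq hn.symm⟩
  refine ⟨M.isSequentialProcedure_leapRule o m₁ m₂ a b, fun A => ?_, fun A => ?_⟩
  · have hsub : {ω | m₁ ≤ ((M.leapRule o m₁ m₂ a b).D ω \ A).card} ⊆
        {ω | M.leapTime o m₁ m₂ a b ω = ⊤} ∪
          {ω | ∃ S, (S ⊆ Aᶜ ∧ S.card ≤ m₁) ∧ ∃ n, b ≤ -M.jointLLR A (A ∪ S) n ω} := by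
      intro ω hω
      refine (hcase ω).imp id fun ⟨n, hs, hD⟩ => ?_
      rw [Set.mem_ofPred_eq, hD] at hω
      obtain ⟨S, hS, _, hcard, hle⟩ := exists_subset_of_falsePositives hs hm₁ hω
      refine ⟨S, ⟨hS, hcard⟩, n, ?_⟩
      have hdisj : Disjoint A S := (Finset.subset_compl_iff_disjoint_left.1 hS)
      rw [jointLLR_eq, sum_diffSign_mul, Finset.sum_union hdisj]
      linarith
    refine (measure_mono hsub).trans ((measure_union_le _ _).trans ?_)
    rw [htop, zero_add]
    exact measure_exists_alternative_le hM (by omega) hα.1 hα.2 A _ (fun S h => h.2)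
      fun S => A ∪ S
  · have hsub : {ω | m₂ ≤ (A \ (M.leapRule o m₁ m₂ a b).D ω).card} ⊆
        {ω | M.leapTime o m₁ m₂ a b ω = ⊤} ∪
          {ω | ∃ S, (S ⊆ A ∧ S.card ≤ m₂) ∧ ∃ n, a ≤ -M.jointLLR A (A \ S) n ω} := by
      intro ω hω
      refine (hcase ω).imp id fun ⟨n, hs, hD⟩ => ?_
      rw [Set.mem_ofPred_eq, hD] at hω
      obtain ⟨S, hS, _, hcard, hle⟩ := exists_subset_of_falseNegatives hs hm₂ hω
      refine ⟨S, ⟨hS, hcard⟩, n, ?_⟩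
      rw [jointLLR_eq, sum_diffSign_mul]
      have := Finset.sum_sdiff (f := fun k => M.llr ω n k) hS
      rw [Finset.sum_neg_distrib] at hle
      linarith
    refine (measure_mono hsub).trans ((measure_union_le _ _).trans ?_)
    rw [htop, zero_add]
    exact measure_exists_alternative_le hM (by omega) hβ.1 hβ.2 A _ (fun S h => h.2)
      fun S => A \ S

/-! ### Comparison with an arbitrary competitor. -/

/-- The exponential is a constant over `α` or over `β`, and `α + β` is at most `1 + C` times either
of them. This is the only place where comparability of `α` and `β` enters. -/
theorem exp_max_threshold_mul_le (hm₁ : m₁ ≤ K) (hm₂ : m₂ ≤ K) {C : ℝ} (hC : 0 < C)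
    {θ : ℝ × ℝ} (hθ : θ ∈ sameRate C) :
    Real.exp (max (leapThreshold K m₂ θ.2) (leapThreshold K m₁ θ.1)) * (θ.1 + θ.2) ≤
      (2 ^ m₁ * (K.choose m₁ : ℝ) + 2 ^ m₂ * (K.choose m₂ : ℝ)) * (1 + C) := by
  obtain ⟨⟨⟨hα, hα'⟩, hβ, hβ'⟩, h1, h2⟩ := hθ
  have N1 := threshold_factor_pos (K := K) (m := m₁) hm₁
  have N2 := threshold_factor_pos (K := K) (m := m₂) hm₂
  rw [inv_mul_le_iff₀ hC] at h1
  rcases le_total (leapThreshold K m₂ θ.2) (leapThreshold K m₁ θ.1) with h | h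
  · rw [max_eq_right h, exp_leapThreshold hm₁ hα hα', div_mul_eq_mul_div, div_le_iff₀ hα]
    nlinarith [mul_pos N1 hα, mul_pos N2 hα, mul_pos (mul_pos N2 hα) hC]
  · rw [max_eq_left h, exp_leapThreshold hm₂ hβ hβ', div_mul_eq_mul_div, div_le_iff₀ hβ]
    nlinarith [mul_pos N1 hβ, mul_pos N2 hβ, mul_pos (mul_pos N1 hβ) hC]

open Classical in
/-- The expected sample size of the Leap rule exceeds that of any competitor at most by a
constant. -/
theorem exists_regret_bound (hM : M.LLRMomentAssumption) (hm₁ : 0 < m₁) (hm₂ : 0 < m₂)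
    (hm : m₁ + m₂ ≤ K) {C : ℝ} (hC : 0 < C) (A : Finset (Fin K)) :
    ∃ R : ℝ≥0∞, R < ⊤ ∧ ∀ θ ∈ sameRate C, ∀ δ ∈ M.gfrClass m₁ m₂ θ.1 θ.2,
      M.ESS A (M.leapRule o m₁ m₂ (leapThreshold K m₂ θ.2) (leapThreshold K m₁ θ.1)) ≤
        M.ESS A δ + R := by
  obtain ⟨L, c, hL, hc, H⟩ := exists_remainingTime_bound o hM A
  set G : ℝ≥0∞ := ENNReal.ofReal
    ((2 ^ m₁ * (K.choose m₁ : ℝ) + 2 ^ m₂ * (K.choose m₂ : ℝ)) * (1 + C)) with hG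
  refine ⟨(ENNReal.ofReal c)⁻¹ * ∑ _B : Finset (Fin K), (G + 1 + ENNReal.ofReal L + G), ?_,
    fun θ hθ δ hδ => ?_⟩
  · refine ENNReal.mul_lt_top (by simpa using hc) (ENNReal.sum_lt_top.2 fun B _ => ?_)
    simp [hG]
  set a := leapThreshold K m₂ θ.2 with ha
  set b := leapThreshold K m₁ θ.1 with hb
  have hab : 0 < max a b :=
    lt_max_of_lt_left (leapThreshold_pos (by omega) hθ.1.2.1 hθ.1.2.2)
  obtain ⟨⟨hT1, hT, hD⟩, herr1, herr2⟩ := hδ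
  -- The event that the competitor stops is cut into the cells `{T = n, D = d}`; each is known at
  -- time `n`, so the remaining-time bound applies with reference decision `d`.
  set E : ℕ × Finset (Fin K) → Set (SamplePath K 𝒳) := fun p =>
    {ω | δ.T ω = p.1} ∩ {ω | δ.D ω = p.2} with hE
  have hEm : ∀ p, MeasurableSet[obsFiltration K 𝒳 p.1] (E p) := fun p => by
    have h1 : MeasurableSet[obsFiltration K 𝒳 p.1]
        ({ω | δ.D ω = p.2} ∩ {ω | δ.T ω ≤ (p.1 : ℕ∞)}) := ((hT.measurableSet _).1 (hD p.2)).2 p.1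
    have h2 : E p = {ω | δ.T ω = p.1} ∩ ({ω | δ.D ω = p.2} ∩ {ω | δ.T ω ≤ (p.1 : ℕ∞)}) := by
      ext ω
      simp only [hE, Set.mem_inter_iff, Set.mem_ofPred_eq]
      exact ⟨fun h => ⟨h.1, h.2, h.1.le⟩, fun h => ⟨h.1, h.2.1⟩⟩
    rw [h2]
    exact (hT.measurableSet_eq p.1).inter h1
  have hEm' : ∀ p, MeasurableSet (E p) := fun p => (obsFiltration K 𝒳).le _ _ (hEm p)
  have hEdisj : Pairwise (Function.onFun Disjoint E) := fun p q hpq => by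
    refine Set.disjoint_left.2 fun ω hp hq => hpq (Prod.ext ?_ (hp.2.symm.trans hq.2))
    have : (p.1 : ℕ∞) = q.1 := hp.1.symm.trans hq.1
    exact_mod_cast this
  have hsum1 : ∀ B, ∑' p, M.P B (E p) ≤ 1 := fun B => by
    rw [← measure_iUnion hEdisj hEm']
    exact prob_le_one
  set g : Finset (Fin K) → ℕ × Finset (Fin K) → ℝ≥0∞ := fun B p =>
    if IsError m₁ m₂ p.2 B then ENNReal.ofReal (Real.exp (max a b)) * M.P B (E p) else 0 with hg
  -- Over the cells whose decision is erroneous at `B`, the `ℙ_B`-probabilities add up to at most `α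
  -- + β`, which compensates the factor `exp (max a b)`.
  have hsum2 : ∀ B, ∑' p, g B p ≤ G := fun B => by
    set E' : ℕ × Finset (Fin K) → Set (SamplePath K 𝒳) := fun p =>
      if IsError m₁ m₂ p.2 B then E p else ∅ with hE'
    have e : ∀ p, g B p = ENNReal.ofReal (Real.exp (max a b)) * M.P B (E' p) := fun p => by
      by_cases h : IsError m₁ m₂ p.2 B <;> simp [hg, hE', h]
    have hsub : ∀ p, E' p ⊆ E p := fun p => by
      by_cases h : IsError m₁ m₂ p.2 B <;> simp [hE', h]
    have hm' : ∀ p, MeasurableSet (E' p) := fun p => by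
      by_cases h : IsError m₁ m₂ p.2 B
      · simpa [hE', h] using hEm' p
      · simp [hE', h]
    have hU : ⋃ p, E' p ⊆ {ω | m₁ ≤ (δ.D ω \ B).card} ∪ {ω | m₂ ≤ (B \ δ.D ω).card} := by
      refine Set.iUnion_subset fun p ω hω => ?_
      by_cases h : IsError m₁ m₂ p.2 B
      · have : δ.D ω = p.2 := (hsub p hω).2
        rw [← this] at h
        exact h
      · simp [hE', h] at hω
    simp_rw [e]
    rw [ENNReal.tsum_mul_left, ← measure_iUnion
      (fun p q hpq => (hEdisj hpq).mono (hsub p) (hsub q)) hm']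
    calc ENNReal.ofReal (Real.exp (max a b)) * M.P B (⋃ p, E' p)
        ≤ ENNReal.ofReal (Real.exp (max a b)) * (ENNReal.ofReal θ.1 + ENNReal.ofReal θ.2) := by
          gcongr
          exact (measure_mono hU).trans ((measure_union_le _ _).trans
            (add_le_add (herr1 B) (herr2 B)))
      _ ≤ G := by
          rw [← ENNReal.ofReal_add hθ.1.1.1.le hθ.1.2.1.le,
            ← ENNReal.ofReal_mul (Real.exp_pos _).le]
          exact ENNReal.ofReal_le_ofReal
            (exp_max_threshold_mul_le (by omega) (by omega) hC hθ)
  -- One right-hand side dominating both cases: the first and third terms serve a decision that is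
  -- acceptable at `A`, the last three an erroneous one.
  have hbound : ∀ p, ENNReal.ofReal c * ∑' j : ℕ,
      M.P A (E p ∩ {ω | ((p.1 + j : ℕ) : ℕ∞) < M.leapTime o m₁ m₂ a b ω}) ≤
      ∑ B, (g B p + M.P B (E p) + ENNReal.ofReal L * M.P A (E p) + g A p) := by
    intro p
    rcases Nat.eq_zero_or_pos p.1 with h0 | hpos
    · have : E p = ∅ := Set.eq_empty_of_forall_notMem fun ω hω => by
        have h1 := hT1 ω
        have h2 : δ.T ω = p.1 := hω.1
        rw [h2, h0] at h1
        exact absurd h1 (by simp)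
      simp [this]
    -- If `p.2` is erroneous at `A` it cannot be the reference decision, so `A` takes its place. The
    -- cost `max a b` per unit of `ℙ_A`-mass is absorbed by `exp (max a b)`, since the cell counts
    -- as an error at `A`.
    by_cases hA : IsError m₁ m₂ p.2 A
    · refine (H m₁ m₂ hm₁ hm₂ a b hab A (not_isError_self hm₁ hm₂ A) p.1 hpos (E p)
        (hEm p)).2.trans (Finset.sum_le_sum fun B _ => ?_)
      have hgA : g A p = ENNReal.ofReal (Real.exp (max a b)) * M.P A (E p) := by simp [hg, hA]
      have hle : ENNReal.ofReal (max a b) ≤ ENNReal.ofReal (Real.exp (max a b)) :=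
        ENNReal.ofReal_le_ofReal (by linarith [Real.add_one_le_exp (max a b)])
      rw [hgA, ENNReal.ofReal_add hab.le hL.le, add_mul]
      calc M.P B (E p) + (ENNReal.ofReal (max a b) * M.P A (E p) +
            ENNReal.ofReal L * M.P A (E p))
          ≤ M.P B (E p) + (ENNReal.ofReal (Real.exp (max a b)) * M.P A (E p) +
            ENNReal.ofReal L * M.P A (E p)) := by gcongr
        _ = 0 + M.P B (E p) + ENNReal.ofReal L * M.P A (E p) +
            ENNReal.ofReal (Real.exp (max a b)) * M.P A (E p) := by ring
        _ ≤ _ := by gcongr; exact zero_le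
    · refine (H m₁ m₂ hm₁ hm₂ a b hab p.2 hA p.1 hpos (E p) (hEm p)).1.trans
        (Finset.sum_le_sum fun B _ => ?_)
      calc g B p + ENNReal.ofReal L * M.P A (E p)
          = g B p + 0 + ENNReal.ofReal L * M.P A (E p) + 0 := by ring
        _ ≤ _ := by gcongr <;> exact zero_le
  set X : ℝ≥0∞ := ∑' p, ∑' j : ℕ,
    M.P A (E p ∩ {ω | ((p.1 + j : ℕ) : ℕ∞) < M.leapTime o m₁ m₂ a b ω}) with hX
  have hXle : ENNReal.ofReal c * X ≤
      ∑ _B : Finset (Fin K), (G + 1 + ENNReal.ofReal L + G) := by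
    rw [hX, ← ENNReal.tsum_mul_left]
    refine (ENNReal.tsum_le_tsum hbound).trans ?_
    rw [Summable.tsum_finsetSum fun _ _ => ENNReal.summable]
    refine Finset.sum_le_sum fun B _ => ?_
    rw [ENNReal.tsum_add, ENNReal.tsum_add, ENNReal.tsum_add, ENNReal.tsum_mul_left]
    gcongr
    · exact hsum2 B
    · exact hsum1 B
    · exact mul_le_of_le_one_right' (hsum1 A)
    · exact hsum2 A
  have hmf : ∀ n : ℕ, Measurable fun ω => ∑' j : ℕ,
      (if ((n + j : ℕ) : ℕ∞) < M.leapTime o m₁ m₂ a b ω then (1 : ℝ≥0∞) else 0) := fun n =>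
    Measurable.tsum fun j => Measurable.ite
      ((obsFiltration K 𝒳).le _ _ (measurableSet_lt_leapTime o a b (n + j)))
      measurable_const measurable_const
  refine le_trans ?_ (add_le_add le_rfl ((ENNReal.mul_le_iff_le_inv
    (ENNReal.ofReal_pos.2 hc).ne' ENNReal.ofReal_ne_top).1 hXle))
  calc M.ESS A (M.leapRule o m₁ m₂ a b)
      ≤ ∫⁻ ω, ((δ.T ω : ℝ≥0∞) + ∑' p, (E p).indicator (fun ω => ∑' j : ℕ,
        (if ((p.1 + j : ℕ) : ℕ∞) < M.leapTime o m₁ m₂ a b ω then (1 : ℝ≥0∞) else 0)) ω)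
        ∂(M.P A) := by
        refine lintegral_mono fun ω => ?_
        by_cases h : δ.T ω = ⊤
        · simp [h]
        obtain ⟨n, hn⟩ := ENat.ne_top_iff_exists.1 h
        refine (ENat.toENNReal_le_add_tsum _ n).trans (add_le_add (by simp [← hn]) ?_)
        refine le_trans ?_ (ENNReal.le_tsum (n, δ.D ω))
        rw [Set.indicator_of_mem (show ω ∈ E (n, δ.D ω) from ⟨hn.symm, rfl⟩)]
        rfl
    _ = M.ESS A δ + X := by
        -- Splitting the integral needs measurability of the second summand only.
        rw [lintegral_add_right _ (Measurable.tsum fun p =>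
          (hmf p.1).indicator (hEm' p)), lintegral_tsum fun p =>
          ((hmf p.1).indicator (hEm' p)).aemeasurable]
        congr 1
        refine tsum_congr fun p => ?_
        rw [lintegral_indicator (hEm' p), lintegral_tsum_ite_lt_leapTime]

end Leap

end StreamModel

theorem mainTheorem6 {K : ℕ} {𝒳 : Fin K → Type*} [∀ k, MeasurableSpace (𝒳 k)]
    (M : StreamModel K 𝒳) (hM : M.LLRMomentAssumption) (o : EvidenceOrder K)
    (m₁ m₂ : ℕ) (hm₁ : 1 ≤ m₁) (hm₂ : 1 ≤ m₂) (hm : m₁ + m₂ ≤ K)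
    (C : ℝ) (hC : 0 < C) :
    M.IsSecondOrderOptimal (sameRate C)
      (fun θ => M.leapRule o m₁ m₂ (leapThreshold K m₂ θ.2) (leapThreshold K m₁ θ.1))
      (fun θ => M.gfrClass m₁ m₂ θ.1 θ.2) := by
  refine ⟨fun θ hθ => StreamModel.leapRule_mem_gfrClass o hM hm₁ hm₂ hm hθ.1 hθ.2,
    fun A => ⟨fun θ hθ => StreamModel.ESS_leapRule_lt_top o hM hm₁ hm₂ A
      (lt_max_of_lt_left (leapThreshold_pos (by omega) hθ.2.1 hθ.2.2)), ?_⟩⟩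
  obtain ⟨R, hR, H⟩ := StreamModel.exists_regret_bound o hM hm₁ hm₂ hm hC A
  refine lt_of_le_of_lt (b := (R : EReal)) ?_ (EReal.coe_ennreal_lt_coe_ennreal_iff.2 hR)
  refine Filter.limsup_le_of_le (h := ?_)
  filter_upwards [self_mem_nhdsWithin] with θ hθ
  have h1 : M.ESS A (M.leapRule o m₁ m₂ (leapThreshold K m₂ θ.2) (leapThreshold K m₁ θ.1)) ≤
      R + M.minESS A (M.gfrClass m₁ m₂ θ.1 θ.2) := by
    -- The constant `R` does not depend on the competitor, so the bound passes to the infimum over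
    -- the class.
    rw [add_comm, ← tsub_le_iff_right]
    exact le_iInf₂ fun δ hδ => tsub_le_iff_right.2 (H θ hθ δ hδ)
  refine EReal.sub_le_of_le_add ?_
  exact_mod_cast h1
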